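/- For a finite simple undirected graph $G$ let $\alpha(G)$ be the maximum size of an independent set and $\beta(G)$ the minimum size of a vertex cover. For a pair $e=\{u,v\}$ of distinct nonadjacent vertices (a nonedge) of $G$, let $G+e$ be the graph obtained from $G$ by adding the edge $e$. For $\xi\in\{\alpha,\beta\}$, the graph $G$ is called $\xi$-unfrozen if $\xi(G+e)=\xi(G)$ for every nonedge $e$ of $G$, and $\xi$-frozen if $\xi(G+e)\neq\xi(G)$ for every nonedge $e$ of $G$. Theorem. Restricted to bipartite graphs, the problems $\beta$-Unfrozenness, $\alpha$-Unfrozenness and $\beta$-Frozenness belong to $\mathrm{P}$. That is, with graphs given by their adjacency matrices as binary words, each of the three languages (1) $\{\langle G\rangle : G \text{ is bipartite and } \beta\text{-unfrozen}\}$, (2) $\{\langle G\rangle : G \text{ is bipartite and } \alpha\text{-unfrozen}\}$, (3) $\{\langle G\rangle : G \text{ is bipartite and } \beta\text{-frozen}\}$ is decided by a deterministic Turing machine whose running time is bounded by a polynomial in the length of the input. -/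

import Mathlib

namespace GraphUnfrozen

/-- `G` is `ξ`-unfrozen: adding any single nonedge of `G` as an edge leaves `ξ` unchanged. -/
def IsUnfrozen {V N : Type*} (ξ : SimpleGraph V → N) (G : SimpleGraph V) : Prop :=
  ∀ u v : V, u ≠ v → ¬ G.Adj u v → ξ (G ⊔ SimpleGraph.edge u v) = ξ G

/-- `G` is `ξ`-frozen: adding any single nonedge of `G` as an edge changes `ξ`. -/
def IsFrozen {V N : Type*} (ξ : SimpleGraph V → N) (G : SimpleGraph V) : Prop :=
  ∀ u v : V, u ≠ v → ¬ G.Adj u v → ξ (G ⊔ SimpleGraph.edge u v) ≠ ξ G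

open Classical in
/-- The binary encoding of a graph with vertices `0, …, n - 1`: the number `n` in unary, ended by
a `0`, followed by the `n × n` adjacency matrix, row by row. -/
noncomputable def encodeGraph {n : ℕ} (G : SimpleGraph (Fin n)) : List Bool :=
  List.replicate n true ++ false ::
    (List.finRange n).flatMap fun i => (List.finRange n).map fun j => decide (G.Adj i j)

/-- Distinct graphs have distinct encodings, so a set of graphs and the set of its encodings
determine each other. -/
theorem encodeGraph_injective :
    Function.Injective fun p : Σ n : ℕ, SimpleGraph (Fin n) => encodeGraph p.2 := by
  have key : ∀ (m n : ℕ) (s t : List Bool),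
      List.replicate m true ++ false :: s = List.replicate n true ++ false :: t →
        m = n ∧ s = t := by
    intro m
    induction m with
    | zero => intro n s t h; cases n <;> simp_all [List.replicate_succ]
    | succ m ih =>
      intro n s t h
      cases n with
      | zero => simp [List.replicate_succ] at h
      | succ n =>
        simp only [List.replicate_succ, List.cons_append, List.cons.injEq, true_and] at h
        obtain ⟨h1, h2⟩ := ih n s t h
        exact ⟨by rw [h1], h2⟩
  have inj : ∀ {n : ℕ} (l : List (Fin n)) (f g : Fin n → List Bool),
      (∀ i, (f i).length = (g i).length) → l.flatMap f = l.flatMap g → ∀ i ∈ l, f i = g i := by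
    intro n l f g hl
    induction l with
    | nil => simp
    | cons a l ih =>
      intro h i hi
      simp only [List.flatMap_cons] at h
      obtain ⟨h1, h2⟩ := List.append_inj h (hl a)
      rcases List.mem_cons.1 hi with rfl | hi
      · exact h1
      · exact ih h2 i hi
  rintro ⟨m, G⟩ ⟨n, H⟩ h
  obtain ⟨rfl, h2⟩ := key _ _ _ _ h
  congr 1
  ext i j
  have h3 := inj _ _ _ (fun i => by simp) h2 i (List.mem_finRange i)
  simpa using List.map_inj_left.1 h3 j (List.mem_finRange j)

/-- The decision problem, as a language over `{0, 1}`, given by a property `Q` of graphs and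
restricted to bipartite graphs: the encodings of all bipartite graphs that satisfy `Q`. -/
def bipartiteProblem (Q : ∀ n : ℕ, SimpleGraph (Fin n) → Prop) : Language Bool :=
  {w | ∃ (n : ℕ) (G : SimpleGraph (Fin n)), G.IsBipartite ∧ Q n G ∧ encodeGraph G = w}

open Classical in
/-- `L` belongs to `P`: some deterministic multi-stack Turing machine halts on every word `w` over
`{0, 1}` within a number of steps polynomial in the length of `w` and outputs whether `w ∈ L`. -/
def InP (L : Language Bool) : Prop :=
  Nonempty (Turing.TM2ComputableInPolyTime (id : List Bool → List Bool) Computability.encodeBool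
    fun w => decide (w ∈ L))

end GraphUnfrozen

/-! Combinatorics. The vertex covers of `G + uv` are the vertex covers of `G` that contain `u` or
`v`. Hence adding the nonedge `uv` raises `β` exactly if no least vertex cover contains `u` and none
contains `v`, that is, if both vertices are spared (`vertexCoverNum_add_edge_eq_iff`). So `G` is
`β`-unfrozen if no nonedge has two spared ends, and `β`-frozen if every nonedge has. As `α + β` is
the number of vertices (`vertexCoverNum_add_indepNum`), `α`-unfrozen and `β`-unfrozen mean the same.
It remains to recognise spared vertices in polynomial time.

To avoid computing a bipartition, every vertex is doubled into a left and a right copy, and an edge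
`xy` joins left `x` to right `y` and left `y` to right `x`. For bipartite `G` the double consists of
two disjoint copies of `G`, so its cover number is `2β(G)` and a cover of it splits into two covers
of `G` (`exists_split`). It follows that `v` is spared exactly if the cover number of the double
does not drop when the left copy of `v` is deleted (`spared_iff`).

By König's theorem these cover numbers are sizes of largest matchings, which an auction finds: a
free left vertex takes a cheapest neighbour, raises its price by one and displaces the former owner.
A left vertex gives up once all its neighbours have reached the price limit. In the end some price
level does not occur, and cutting the prices there yields a cover as large as the matching
(`Valid.coverNum_eq`). Every bid raises one of boundedly many prices, so the time is polynomial.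
Bipartiteness itself is tested by closing the relation "joined by an even walk" under two further
edges.

Machines. Programs are written in a language whose only loops run `N` times, `N` being one more than
the input length; polynomial time is then automatic. Programs on stacks are compiled to Turing
machines (`gets_code`, `inP_of_stackProg`), and programs on `N × N` boolean tables are compiled to
programs on stacks (`exec_toStack`, `inP_of_tabProg`). The decision procedure is a table program,
verified by loop invariants in `run_decideProg`. -/

namespace GraphUnfrozen

open Turing StateTransition

/-! ### Stack programs with bounded loops, and their machine code -/

/-- Structured programs over boolean stacks. The only loop repeats its body a number of times
that is fixed in advance. -/
inductive StackProg (S : Type) where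
  | skip
  | push (k : S) (b : Bool)
  | pop (k : S)
  | ifTop (k : S) (pe pf pt : StackProg S)
  | seq (p q : StackProg S)
  | rep (p : StackProg S)

namespace StackProg

variable {S : Type} {Λ : Type}

/-- The effect of a program on the stacks, each `rep` making `N` rounds. -/
def exec [DecidableEq S] (N : ℕ) : StackProg S → (S → List Bool) → S → List Bool
  | skip, T => T
  | push k b, T => Function.update T k (b :: T k)
  | pop k, T => Function.update T k (T k).tail
  | ifTop k pe pf pt, T =>
    match (T k).head? with
    | none => exec N pe T
    | some false => exec N pf T
    | some true => exec N pt T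
  | seq p q, T => exec N q (exec N p T)
  | rep p, T => (exec N p)^[N] T

/-- A bound for the running time, as a polynomial in the number of rounds of the loops. -/
noncomputable def cost : StackProg S → Polynomial ℕ
  | skip => 1
  | push _ _ => 1
  | pop _ => 1
  | ifTop _ pe pf pt => 1 + (cost pe + cost pf + cost pt)
  | seq p q => cost p + cost q
  | rep p => Polynomial.X * (cost p + 1) + 1 + (Polynomial.X + 1)

/-- A push adds one symbol and costs one step, so the time bound also bounds the growth of every
stack. This limits the time for emptying the stacks at the end. -/
theorem length_exec_le [DecidableEq S] (N : ℕ) (p : StackProg S) (T : S → List Bool) (k : S) :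
    (exec N p T k).length ≤ (T k).length + p.cost.eval N := by
  induction p generalizing T with
  | skip => simp [exec]
  | push k' b =>
    by_cases h : k = k'
    · subst h; simp [exec, cost]
    · simp [exec, cost, h]
  | pop k' =>
    by_cases h : k = k'
    · subst h; simp [exec, cost]; omega
    · simp [exec, cost, h]
  | ifTop k' pe pf pt he hf ht =>
    have := he T
    have := hf T
    have := ht T
    simp only [exec, cost, Polynomial.eval_add, Polynomial.eval_one]
    rcases (T k').head? with - | (- | -) <;> dsimp only <;> omega
  | seq p q hp hq =>
    have := hp T
    have := hq (exec N p T)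
    simp only [exec, cost, Polynomial.eval_add]
    omega
  | rep p hp =>
    have key : ∀ n, ((exec N p)^[n] T k).length ≤ (T k).length + n * p.cost.eval N := by
      intro n
      induction n with
      | zero => simp
      | succ n ih =>
        rw [Function.iterate_succ_apply']
        have := hp ((exec N p)^[n] T)
        rw [add_mul]
        omega
    have := key N
    simp only [exec, cost, Polynomial.eval_add, Polynomial.eval_mul, Polynomial.eval_X,
      Polynomial.eval_one, mul_add]
    omega

/-- The control points of a program. -/
inductive Label : StackProg S → Type where
  | skip : Label .skip
  | push {k : S} {b : Bool} : Label (.push k b)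
  | pop {k : S} : Label (.pop k)
  | test {k : S} {pe pf pt : StackProg S} : Label (.ifTop k pe pf pt)
  | onEmpty {k : S} {pe pf pt : StackProg S} (l : Label pe) : Label (.ifTop k pe pf pt)
  | onFalse {k : S} {pe pf pt : StackProg S} (l : Label pf) : Label (.ifTop k pe pf pt)
  | onTrue {k : S} {pe pf pt : StackProg S} (l : Label pt) : Label (.ifTop k pe pf pt)
  | first {p q : StackProg S} (l : Label p) : Label (.seq p q)
  | second {p q : StackProg S} (l : Label q) : Label (.seq p q)
  | round {p : StackProg S} : Label (.rep p)
  | restore {p : StackProg S} : Label (.rep p)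
  | body {p : StackProg S} (l : Label p) : Label (.rep p)

instance finite_label (p : StackProg S) : Finite (Label p) := by
  induction p with
  | skip => exact Finite.of_surjective (fun _ : Unit => Label.skip) fun l => by cases l; simp
  | push k b => exact Finite.of_surjective (fun _ : Unit => Label.push) fun l => by cases l; simp
  | pop k => exact Finite.of_surjective (fun _ : Unit => Label.pop) fun l => by cases l; simp
  | ifTop k pe pf pt _ _ _ =>
    exact Finite.of_surjective
      (fun x : Unit ⊕ Label pe ⊕ Label pf ⊕ Label pt => match x with
        | .inl _ => Label.test (k := k)
        | .inr (.inl l) => .onEmpty l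
        | .inr (.inr (.inl l)) => .onFalse l
        | .inr (.inr (.inr l)) => .onTrue l) fun l => by cases l <;> simp
  | seq p q _ _ =>
    exact Finite.of_surjective (fun x : Label p ⊕ Label q => match x with
      | .inl l => Label.first l
      | .inr l => .second l) fun l => by cases l <;> simp
  | rep p _ =>
    exact Finite.of_surjective (fun x : Bool ⊕ Label p => match x with
      | .inl false => Label.round
      | .inl true => .restore
      | .inr l => .body l) fun l => by cases l <;> simp

/-- The control point at which a program begins. -/
def entry : (p : StackProg S) → Label p
  | skip => .skip
  | push _ _ => .push
  | pop _ => .pop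
  | ifTop _ _ _ _ => .test
  | seq p _ => .first (entry p)
  | rep _ => .round

/-- The stacks of a machine: those of the program, and two for each label to count rounds. -/
abbrev Stacks (S Λ : Type) : Type := S ⊕ Λ × Bool

/-- The internal states of a machine: the symbol read last, and the answer. -/
abbrev Register : Type := Option Bool × Bool

/-- Machine statements over boolean stacks. -/
abbrev Code (S Λ : Type) : Type := TM2.Stmt (fun _ : Stacks S Λ => Bool) Λ Register

/-- Machine configurations over boolean stacks. -/
abbrev Config (S Λ : Type) : Type := TM2.Cfg (fun _ : Stacks S Λ => Bool) Λ Register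

open TM2.Stmt in
/-- The machine code at a control point of a program whose control points are placed at the labels
`emb`, and that continues at `exit`. -/
def code : {p : StackProg S} → Label p → (Label p → Λ) → Λ → Code S Λ
  | _, .skip, _, exit => goto fun _ => exit
  | .push k b, .push, _, exit => TM2.Stmt.push (.inl k) (fun _ => b) (goto fun _ => exit)
  | .pop k, .pop, _, exit => TM2.Stmt.pop (.inl k) (fun v _ => v) (goto fun _ => exit)
  | .ifTop k pe pf pt, .test, emb, _ =>
    peek (.inl k) (fun v t => (t, v.2)) (goto fun v =>
      match v.1 with
      | none => emb (.onEmpty pe.entry)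
      | some false => emb (.onFalse pf.entry)
      | some true => emb (.onTrue pt.entry))
  | _, .onEmpty l, emb, exit => code l (fun l => emb (.onEmpty l)) exit
  | _, .onFalse l, emb, exit => code l (fun l => emb (.onFalse l)) exit
  | _, .onTrue l, emb, exit => code l (fun l => emb (.onTrue l)) exit
  | .seq _ q, .first l, emb, _ => code l (fun l => emb (.first l)) (emb (.second q.entry))
  | _, .second l, emb, exit => code l (fun l => emb (.second l)) exit
  | .rep p, .round, emb, _ =>
    TM2.Stmt.pop (.inr (emb .round, false)) (fun v t => (t, v.2)) <|
      branch (fun v => v.1.isSome)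
        (TM2.Stmt.push (.inr (emb .round, true)) (fun _ => true) (goto fun _ => emb (.body p.entry)))
        (goto fun _ => emb .restore)
  | _, .restore, emb, exit =>
    TM2.Stmt.pop (.inr (emb .round, true)) (fun v t => (t, v.2)) <|
      branch (fun v => v.1.isSome)
        (TM2.Stmt.push (.inr (emb .round, false)) (fun _ => true) (goto fun _ => emb .restore))
        (goto fun _ => exit)
  | _, .body l, emb, _ => code l (fun l => emb (.body l)) (emb .round)

/-- The machine gets from one configuration to another within `t` steps. -/
def Gets [DecidableEq S] [DecidableEq Λ] (M : Λ → Code S Λ) (c c' : Config S Λ) (t : ℕ) : Prop :=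
  Nonempty (EvalsToInTime (TM2.step M) c (some c') t)

section

variable [DecidableEq S] [DecidableEq Λ] {M : Λ → Code S Λ}

theorem Gets.trans {c₁ c₂ c₃ : Config S Λ} {t u : ℕ} (h : Gets M c₁ c₂ t) (h' : Gets M c₂ c₃ u) :
    Gets M c₁ c₃ (t + u) := by
  obtain ⟨h⟩ := h
  obtain ⟨h'⟩ := h'
  exact add_comm u t ▸ ⟨EvalsToInTime.trans _ _ _ _ _ _ h h'⟩

theorem Gets.mono {c c' : Config S Λ} {t u : ℕ} (h : Gets M c c' t) (htu : t ≤ u) :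
    Gets M c c' u := by
  obtain ⟨h⟩ := h
  exact ⟨⟨h.toEvalsTo, h.steps_le_m.trans htu⟩⟩

theorem Gets.step {l : Λ} {v : Register} {T : Stacks S Λ → List Bool} {c : Config S Λ}
    (h : TM2.stepAux (M l) v T = c) : Gets M ⟨some l, v, T⟩ c 1 :=
  ⟨⟨⟨1, by simp [flip, ← h]⟩, le_rfl⟩⟩

/-- The code of a program has the effect of the program, within the time of its cost. -/
theorem gets_code (N : ℕ) (p : StackProg S) (emb : Label p → Λ) (hemb : Function.Injective emb)
    (exit : Λ) (hM : ∀ l, M (emb l) = code l emb exit) (T : S → List Bool)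
    (C : Λ × Bool → List Bool) (hC : ∀ l, C (emb l, false) = List.replicate N true)
    (hC' : ∀ l, C (emb l, true) = []) (v : Register) :
    ∃ v', Gets M ⟨some (emb p.entry), v, Sum.elim T C⟩ ⟨some exit, v', Sum.elim (exec N p T) C⟩
      (p.cost.eval N) := by
  induction p generalizing exit T C v with
  | skip =>
    refine ⟨v, ?_⟩
    simp only [cost, Polynomial.eval_one]
    exact Gets.step (by rw [hM]; simp [code, entry, exec, -Sum.elim_update_left])
  | push k b =>
    refine ⟨v, ?_⟩
    simp only [cost, Polynomial.eval_one]
    exact Gets.step (by rw [hM]; simp [code, entry, exec, -Sum.elim_update_left])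
  | pop k =>
    refine ⟨v, ?_⟩
    simp only [cost, Polynomial.eval_one]
    exact Gets.step (by rw [hM]; simp [code, entry, exec, -Sum.elim_update_left])
  | ifTop k pe pf pt he hf ht =>
    have h1 : ∀ l, (∀ t, t = (T k).head? → l = match t with
        | none => emb (.onEmpty pe.entry)
        | some false => emb (.onFalse pf.entry)
        | some true => emb (.onTrue pt.entry)) →
        Gets M ⟨some (emb (ifTop k pe pf pt).entry), v, Sum.elim T C⟩
          ⟨some l, ((T k).head?, v.2), Sum.elim T C⟩ 1 := by
      intro l hl
      refine Gets.step ?_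
      rw [hM, hl _ rfl]
      simp [code, entry]
    rcases h : (T k).head? with - | (- | -)
    · obtain ⟨v', h'⟩ := he (fun l => emb (.onEmpty l))
        (fun a b hab => by simpa using hemb hab) exit (fun l => hM _) T C (fun l => hC _)
        (fun l => hC' _) ((T k).head?, v.2)
      refine ⟨v', ((h1 _ fun t ht => ?_).trans (by simpa [exec, h] using h')).mono ?_⟩
      · simp [ht, h]
      · simp only [cost, Polynomial.eval_add, Polynomial.eval_one]; omega
    · obtain ⟨v', h'⟩ := hf (fun l => emb (.onFalse l))
        (fun a b hab => by simpa using hemb hab) exit (fun l => hM _) T C (fun l => hC _)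
        (fun l => hC' _) ((T k).head?, v.2)
      refine ⟨v', ((h1 _ fun t ht => ?_).trans (by simpa [exec, h] using h')).mono ?_⟩
      · simp [ht, h]
      · simp only [cost, Polynomial.eval_add, Polynomial.eval_one]; omega
    · obtain ⟨v', h'⟩ := ht (fun l => emb (.onTrue l))
        (fun a b hab => by simpa using hemb hab) exit (fun l => hM _) T C (fun l => hC _)
        (fun l => hC' _) ((T k).head?, v.2)
      refine ⟨v', ((h1 _ fun t ht => ?_).trans (by simpa [exec, h] using h')).mono ?_⟩
      · simp [ht, h]
      · simp only [cost, Polynomial.eval_add, Polynomial.eval_one]; omega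
  | seq p q hp hq =>
    obtain ⟨v₁, h₁⟩ := hp (fun l => emb (.first l)) (fun a b hab => by simpa using hemb hab)
      (emb (.second q.entry)) (fun l => hM _) T C (fun l => hC _) (fun l => hC' _) v
    obtain ⟨v₂, h₂⟩ := hq (fun l => emb (.second l)) (fun a b hab => by simpa using hemb hab)
      exit (fun l => hM _) (exec N p T) C (fun l => hC _) (fun l => hC' _) v₁
    exact ⟨v₂, by simpa [cost, exec, entry] using h₁.trans h₂⟩
  | rep p hp =>
    set h := emb .round with hh
    set r := emb .restore with hr
    -- The counter of this loop with `j` rounds to go and `i` rounds done; the counters of the loops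
    -- in the body are as in `C`.
    let D : ℕ → ℕ → Λ × Bool → List Bool := fun j i =>
      Function.update (Function.update C (h, false) (List.replicate j true)) (h, true)
        (List.replicate i true)
    have hD : ∀ j i l b, D j i (emb (.body l), b) = C (emb (.body l), b) := by
      intro j i l b
      have : emb (.body l) ≠ h := fun e => by simpa using hemb e
      simp [D, this]
    have hDC : D N 0 = C := by
      simp only [D, List.replicate_zero]
      rw [← hC .round, Function.update_eq_self, ← hC' .round, Function.update_eq_self]
    have hDf : ∀ j i, D j i (h, false) = List.replicate j true := fun j i => by simp [D]
    have hDt : ∀ j i, D j i (h, true) = List.replicate i true := fun j i => by simp [D]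
    have hDuf : ∀ j j' i, Function.update (D j i) (h, false) (List.replicate j' true) = D j' i := by
      intro j j' i
      simp only [D]
      rw [Function.update_comm (by simp), Function.update_idem]
    have hDut : ∀ j i i', Function.update (D j i) (h, true) (List.replicate i' true) = D j i' := by
      intro j i i'
      simp only [D, Function.update_idem]
    have loop : ∀ j i (T : S → List Bool) (v : Register), ∃ v',
        Gets M ⟨some h, v, Sum.elim T (D j i)⟩
          ⟨some r, v', Sum.elim ((exec N p)^[j] T) (D 0 (i + j))⟩
          (j * (p.cost.eval N + 1) + 1) := by
      intro j
      induction j with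
      | zero =>
        intro i T v
        refine ⟨(none, v.2), ?_⟩
        simp only [zero_mul, zero_add]
        refine Gets.step ?_
        rw [hh, hM]
        simp only [code, TM2.stepAux, Sum.elim_inr, Sum.update_elim_inr, ← hh, hDf]
        simpa [-Sum.elim_update_right, ← hr] using congrArg (Sum.elim T) (hDuf 0 0 i)
      | succ j ih =>
        intro i T v
        have h1 : Gets M ⟨some h, v, Sum.elim T (D (j + 1) i)⟩
            ⟨some (emb (.body p.entry)), (some true, v.2), Sum.elim T (D j (i + 1))⟩ 1 := by
          refine Gets.step ?_
          rw [hh, hM]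
          simp only [code, TM2.stepAux, Sum.elim_inr, Sum.update_elim_inr, ← hh, hDf, List.head?_replicate,
            List.tail_replicate, hDuf, Nat.add_sub_cancel, hDt, ← List.replicate_succ, hDut]
          simp
        obtain ⟨v₁, h₁⟩ := hp (fun l => emb (.body l)) (fun a b hab => by simpa using hemb hab)
          h (fun l => hM _) T (D j (i + 1)) (fun l => by rw [hD]; exact hC _)
          (fun l => by rw [hD]; exact hC' _) (some true, v.2)
        obtain ⟨v₂, h₂⟩ := ih (i + 1) (exec N p T) v₁
        refine ⟨v₂, ?_⟩
        rw [Function.iterate_succ_apply, ← add_assoc i j 1, add_right_comm]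
        exact ((h1.trans h₁).trans h₂).mono (by ring_nf; omega)
    have restore : ∀ i j (T : S → List Bool) (v : Register), ∃ v',
        Gets M ⟨some r, v, Sum.elim T (D j i)⟩ ⟨some exit, v', Sum.elim T (D (j + i) 0)⟩
          (i + 1) := by
      intro i
      induction i with
      | zero =>
        intro j T v
        refine ⟨(none, v.2), Gets.step ?_⟩
        rw [hr, hM]
        simp only [code, TM2.stepAux, Sum.elim_inr, Sum.update_elim_inr, ← hh, hDt]
        simpa [-Sum.elim_update_right] using congrArg (Sum.elim T) (hDut j 0 0)
      | succ i ih =>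
        intro j T v
        have h1 : Gets M ⟨some r, v, Sum.elim T (D j (i + 1))⟩
            ⟨some r, (some true, v.2), Sum.elim T (D (j + 1) i)⟩ 1 := by
          refine Gets.step ?_
          rw [hr, hM]
          simp only [code, TM2.stepAux, Sum.elim_inr, Sum.update_elim_inr, ← hh, ← hr, hDt, List.head?_replicate,
            List.tail_replicate, hDut, Nat.add_sub_cancel, hDf, ← List.replicate_succ, hDuf]
          simp
        obtain ⟨v₂, h₂⟩ := ih (j + 1) T (some true, v.2)
        refine ⟨v₂, ?_⟩
        rw [show j + (i + 1) = j + 1 + i by omega]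
        exact (h1.trans h₂).mono (by omega)
    -- The rounds and the exit take `N * (cost + 1) + 1` steps, putting the counter back takes `N +
    -- 1`. The counter is full again afterwards, as an enclosing loop needs it when it reenters this
    -- one.
    obtain ⟨v₁, h₁⟩ := loop N 0 T v
    obtain ⟨v₂, h₂⟩ := restore (0 + N) 0 ((exec N p)^[N] T) v₁
    refine ⟨v₂, ?_⟩
    have := h₁.trans h₂
    simp only [zero_add, hDC] at this
    simpa [cost, exec, entry] using this

end

/-! ### The complete machine: loading, running, answering, cleaning -/

variable {S : Type} {Λ : Type}

/-- The stages of the machine for a program, besides the program itself. -/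
inductive Stage where
  | start | load | answer | clean
  deriving DecidableEq

instance : Fintype Stage :=
  ⟨{.start, .load, .answer, .clean}, fun s => by cases s <;> simp⟩

/-- Pushes one symbol on the round counters of all labels in a list. -/
def pushAll (L : List Λ) (q : Code S Λ) : Code S Λ :=
  L.foldr (fun l q => TM2.Stmt.push (.inr (l, false)) (fun _ => true) q) q

/-- Pops one symbol off each stack in a list and records whether there was any. -/
def popAll (L : List (Stacks S Λ)) (q : Code S Λ) : Code S Λ :=
  L.foldr (fun k q => TM2.Stmt.pop k (fun v t => (v.1.or t, v.2)) q) q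

/-- A machine statement may act on many stacks before it jumps, so all counters are raised within a
single step. Without repetitions in the list each is raised exactly once. -/
theorem stepAux_pushAll [DecidableEq S] [DecidableEq Λ] (L : List Λ) (hL : L.Nodup) (q : Code S Λ)
    (v : Register) (T : S → List Bool) (C C' : Λ × Bool → List Bool)
    (h : ∀ l ∈ L, C' (l, false) = true :: C (l, false)) (h' : ∀ l ∉ L, C' (l, false) = C (l, false))
    (h'' : ∀ l, C' (l, true) = C (l, true)) :
    TM2.stepAux (pushAll L q) v (Sum.elim T C) = TM2.stepAux q v (Sum.elim T C') := by
  induction L generalizing C with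
  | nil =>
    have : C = C' := by
      funext ⟨l, b⟩
      cases b
      · exact (h' l (by simp)).symm
      · exact (h'' l).symm
    rw [this]
    rfl
  | cons l L ih =>
    obtain ⟨hl, hL⟩ := List.nodup_cons.1 hL
    have e : pushAll (l :: L) q =
        TM2.Stmt.push (.inr (l, false)) (fun _ => true) (pushAll L q) := rfl
    rw [e]
    simp only [TM2.stepAux, Sum.elim_inr, Sum.update_elim_inr]
    refine ih hL _ (fun m hm => ?_) (fun m hm => ?_) (fun m => ?_)
    · have : m ≠ l := by rintro rfl; exact hl hm
      simp [h m (by simp [hm]), this]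
    · by_cases hml : m = l
      · subst hml; simp [h m]
      · simp [h' m (by simp [hm, hml]), hml]
    · simp [h'']

/-- The register keeps the first symbol found, so it stays empty only if all stacks in the list were
empty; this is the test for the end of the cleaning. -/
theorem stepAux_popAll [DecidableEq S] [DecidableEq Λ] (L : List (Stacks S Λ)) (hL : L.Nodup)
    (q : Code S Λ) (v : Register) (T T' : Stacks S Λ → List Bool)
    (h : ∀ k ∈ L, T' k = (T k).tail) (h' : ∀ k ∉ L, T' k = T k) :
    ∃ t : Option Bool, (t.isSome ↔ v.1.isSome ∨ ∃ k ∈ L, T k ≠ []) ∧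
      TM2.stepAux (popAll L q) v T = TM2.stepAux q (t, v.2) T' := by
  induction L generalizing v T with
  | nil =>
    have : T' = T := funext fun k => h' k (by simp)
    exact ⟨v.1, by simp, by rw [this]; rfl⟩
  | cons k L ih =>
    obtain ⟨hk, hL⟩ := List.nodup_cons.1 hL
    have e : popAll (k :: L) q =
        TM2.Stmt.pop k (fun v t => (v.1.or t, v.2)) (popAll L q) := rfl
    rw [e]
    simp only [TM2.stepAux]
    have ne : ∀ k' ∈ L, Function.update T k (T k).tail k' = T k' := fun k' hk' =>
      Function.update_of_ne (by rintro rfl; exact hk hk') _ _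
    obtain ⟨t, h1, h2⟩ := ih hL (v.1.or (T k).head?, v.2) (Function.update T k (T k).tail)
      (fun k' hk' => by rw [ne k' hk', h k' (by simp [hk'])])
      (fun k' hk' => by
        by_cases hkk : k' = k
        · subst hkk; simp [h k']
        · simp [h' k' (by simp [hk', hkk]), hkk])
    refine ⟨t, ?_, h2⟩
    rw [h1]
    simp only [Option.isSome_or, Bool.or_eq_true, List.isSome_head?, List.mem_cons,
      exists_eq_or_imp, or_assoc]
    refine or_congr Iff.rfl (or_congr (by simp) ?_)
    exact exists_congr fun k' => and_congr_right fun hk' => by rw [ne k' hk']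

/-- The labels of the machine for a program. -/
abbrev MachineLabel (p : StackProg S) : Type := Stage ⊕ Label p

variable [DecidableEq S]

noncomputable instance (p : StackProg S) : Fintype (Label p) := Fintype.ofFinite _

noncomputable instance (p : StackProg S) : DecidableEq (Label p) := Classical.decEq _

/-- Stacks in which every label has a counter of `n` rounds. -/
def counters (p : StackProg S) (n : ℕ) : MachineLabel p × Bool → List Bool :=
  fun x => if x.2 = false then List.replicate n true else []

theorem stepAux_pushAll_counters (p : StackProg S) (n : ℕ) (q : Code S (MachineLabel p))
    (v : Register) (T : S → List Bool) :
    TM2.stepAux (pushAll Finset.univ.toList q) v (Sum.elim T (counters p n)) =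
      TM2.stepAux q v (Sum.elim T (counters p (n + 1))) :=
  stepAux_pushAll _ (Finset.nodup_toList _) _ _ _ _ _
    (by simp [counters, List.replicate_succ]) (by simp) (by simp [counters])

variable [Fintype S]

open TM2.Stmt in
/-- The code of the machine that counts its input while it moves it from the stack `src` to the
stack `dst`, runs the program, and answers with the top of the stack `out`. -/
noncomputable def machineCode (p : StackProg S) (src dst out : S) :
    MachineLabel p → Code S (MachineLabel p)
  | .inl .start => pushAll Finset.univ.toList (goto fun _ => .inl .load)
  | .inl .load => TM2.Stmt.pop (.inl src) (fun v t => (t, v.2)) <|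
      branch (fun v => v.1.isSome)
        (TM2.Stmt.push (.inl dst) (fun v => v.1.getD false) <|
          pushAll Finset.univ.toList (goto fun _ => .inl .load))
        (goto fun _ => .inr p.entry)
  | .inl .answer => peek (.inl out) (fun _ t => (none, t == some true)) (goto fun _ => .inl .clean)
  | .inl .clean => load (fun v => (none, v.2)) <| popAll Finset.univ.toList <|
      branch (fun v => v.1.isSome) (goto fun _ => .inl .clean) <|
        TM2.Stmt.push (.inl out) (fun v => v.2) (load (fun _ => (none, false)) halt)
  | .inr l => code l .inr (.inl .answer)

/-- The machine for a program. -/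
noncomputable def machine (p : StackProg S) (src dst out : S) : FinTM2 where
  K := Stacks S (MachineLabel p)
  k₀ := .inl src
  k₁ := .inl out
  Γ _ := Bool
  Λ := MachineLabel p
  main := .inl .start
  σ := Register
  initialState := (none, false)
  m := machineCode p src dst out

theorem gets_start (p : StackProg S) (src dst out : S) (T : S → List Bool) (v : Register) :
    Gets (machineCode p src dst out) ⟨some (.inl .start), v, Sum.elim T (counters p 0)⟩
      ⟨some (.inl .load), v, Sum.elim T (counters p 1)⟩ 1 := by
  refine Gets.step ?_
  rw [machineCode, stepAux_pushAll_counters]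
  rfl

/-- Each symbol moved raises all counters by one. As the stage `start` has raised them once, loops
make one round more than the input is long. The word arrives in reverse order. -/
theorem gets_load (p : StackProg S) (src dst out : S) (h : src ≠ dst) (w u : List Bool) (n : ℕ)
    (v : Register) : ∃ v', Gets (machineCode p src dst out)
      ⟨some (.inl .load), v,
        Sum.elim (Function.update (Function.update (fun _ => []) src w) dst u) (counters p n)⟩
      ⟨some (.inr p.entry), v',
        Sum.elim (Function.update (fun _ => []) dst (w.reverse ++ u)) (counters p (n + w.length))⟩
      (w.length + 1) := by
  induction w generalizing u n v with
  | nil =>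
    refine ⟨(none, v.2), Gets.step ?_⟩
    simp only [machineCode, TM2.stepAux, Sum.elim_inl, Sum.update_elim_inl]
    rw [Function.update_of_ne h, Function.update_comm h]
    simp [-Sum.elim_update_left, Function.update_comm h.symm]
  | cons b w ih =>
    obtain ⟨v', hv⟩ := ih (b :: u) (n + 1) (some b, v.2)
    refine ⟨v', ?_⟩
    have h1 : Gets (machineCode p src dst out)
        ⟨some (.inl .load), v, Sum.elim (Function.update (Function.update (fun _ => []) src
          (b :: w)) dst u) (counters p n)⟩
        ⟨some (.inl .load), (some b, v.2), Sum.elim (Function.update (Function.update (fun _ => [])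
          src w) dst (b :: u)) (counters p (n + 1))⟩ 1 := by
      refine Gets.step ?_
      simp only [machineCode, TM2.stepAux, Sum.elim_inl, Sum.update_elim_inl,
        stepAux_pushAll_counters]
      rw [Function.update_of_ne h, Function.update_comm h.symm]
      simp [-Sum.elim_update_left]
    have e : n + (b :: w).length = n + 1 + w.length := by simp; omega
    rw [e, List.reverse_cons, List.append_assoc]
    exact (h1.trans hv).mono (by simp; omega)

theorem gets_answer (p : StackProg S) (src dst out : S) (T : Stacks S (MachineLabel p) → List Bool)
    (v : Register) : Gets (machineCode p src dst out) ⟨some (.inl .answer), v, T⟩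
      ⟨some (.inl .clean), (none, (T (.inl out)).head? == some true), T⟩ 1 :=
  Gets.step (by simp [machineCode])

/-- A machine must halt with all stacks empty except for the output. Each sweep pops every stack
once; the first sweep that finds nothing writes the answer, so `m + 1` sweeps suffice for stacks of
height at most `m`. -/
theorem gets_clean (p : StackProg S) (src dst out : S) (m : ℕ)
    (T : Stacks S (MachineLabel p) → List Bool) (hT : ∀ k, (T k).length ≤ m) (v : Register) :
    Gets (machineCode p src dst out) ⟨some (.inl .clean), v, T⟩
      ⟨none, (none, false), Function.update (fun _ => []) (.inl out) [v.2]⟩ (m + 1) := by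
  induction m generalizing T v with
  | zero =>
    refine Gets.step ?_
    obtain ⟨t, h1, h2⟩ := stepAux_popAll (Finset.univ : Finset (Stacks S (MachineLabel p))).toList
      (Finset.nodup_toList _) (TM2.Stmt.branch (fun v => v.1.isSome)
        (TM2.Stmt.goto fun _ => .inl .clean) <| TM2.Stmt.push (.inl out) (fun v => v.2)
          (TM2.Stmt.load (fun _ => (none, false)) TM2.Stmt.halt)) (none, v.2) T
      (fun k => (T k).tail) (by simp) (by simp)
    have hT : ∀ k, T k = [] := fun k => List.length_eq_zero_iff.1 (Nat.le_zero.1 (hT k))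
    have ht : t = none := by
      rw [← Option.not_isSome_iff_eq_none, h1]
      simp [hT]
    simp only [machineCode, TM2.stepAux]
    rw [h2, ht]
    simp [hT]
  | succ m ih =>
    obtain ⟨t, h1, h2⟩ := stepAux_popAll (Finset.univ : Finset (Stacks S (MachineLabel p))).toList
      (Finset.nodup_toList _) (TM2.Stmt.branch (fun v => v.1.isSome)
        (TM2.Stmt.goto fun _ => .inl .clean) <| TM2.Stmt.push (.inl out) (fun v => v.2)
          (TM2.Stmt.load (fun _ => (none, false)) TM2.Stmt.halt)) (none, v.2) T
      (fun k => (T k).tail) (by simp) (by simp)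
    by_cases hn : t.isSome
    · have h3 : Gets (machineCode p src dst out) ⟨some (.inl .clean), v, T⟩
          ⟨some (.inl .clean), (t, v.2), fun k => (T k).tail⟩ 1 := by
        refine Gets.step ?_
        simp only [machineCode, TM2.stepAux]
        rw [h2]
        simp [hn]
      exact (h3.trans (ih (fun k => (T k).tail) (fun k => by
        have := hT k; simp only [List.length_tail]; omega) (t, v.2))).mono (by omega)
    · refine Gets.mono (Gets.step ?_) (by omega)
      have hT : ∀ k, T k = [] := by
        rw [h1] at hn
        simpa using hn
      have ht : t = none := Option.not_isSome_iff_eq_none.1 hn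
      simp only [machineCode, TM2.stepAux]
      rw [h2, ht]
      simp [hT]

theorem gets_machine (p : StackProg S) (src dst out : S) (h : src ≠ dst) (w : List Bool) :
    Gets (machineCode p src dst out)
      ⟨some (.inl .start), (none, false), Function.update (fun _ => []) (.inl src) w⟩
      ⟨none, (none, false), Function.update (fun _ => []) (.inl out)
        [(exec (w.length + 1) p (Function.update (fun _ => []) dst w.reverse) out).head?
          == some true]⟩
      ((2 * p.cost.comp (Polynomial.X + 1) + 2 * Polynomial.X + 5).eval w.length) := by
  set N := w.length + 1
  have e0 : (Function.update (fun _ => []) (.inl src) w : Stacks S (MachineLabel p) → List Bool) =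
      Sum.elim (Function.update (Function.update (fun _ => []) src w) dst []) (counters p 0) := by
    have : counters p 0 = fun _ => [] := by funext x; simp [counters]
    rw [this, Function.update_comm h, Function.update_eq_self dst (fun _ : S => ([] : List Bool)),
      ← Sum.update_elim_inl]
    congr 1
    funext k
    cases k <;> rfl
  obtain ⟨v1, h1⟩ := gets_load p src dst out h w [] 1 (none, false)
  obtain ⟨v2, h2⟩ := gets_code (M := machineCode p src dst out) N p .inr Sum.inr_injective
    (.inl .answer) (fun _ => rfl) (Function.update (fun _ => []) dst w.reverse)
    (counters p N) (fun l => by simp [counters]) (fun l => by simp [counters]) v1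
  have h3 := gets_answer p src dst out (Sum.elim (exec N p
    (Function.update (fun _ => []) dst w.reverse)) (counters p N)) v2
  have h4 := gets_clean p src dst out (N + p.cost.eval N) (Sum.elim (exec N p
    (Function.update (fun _ => []) dst w.reverse)) (counters p N)) (fun k => by
      rcases k with k | ⟨l, b⟩
      · refine (length_exec_le N p _ k).trans ?_
        have : (Function.update (fun _ => []) dst w.reverse k).length ≤ N := by
          by_cases hk : k = dst
          · subst hk; simp [N]
          · simp [hk]
        omega
      · cases b <;> simp [counters])
    (none, (exec N p (Function.update (fun _ => []) dst w.reverse) out).head? == some true)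
  rw [e0]
  rw [List.append_nil, add_comm 1] at h1
  -- With `c` the cost at `N`, the stages take `1`, `w.length + 1`, `c`, `1` and `N + c + 1` steps,
  -- which add up to `2 * c + 2 * w.length + 5`.
  refine ((((gets_start p src dst out _ _).trans h1).trans h2).trans (h3.trans h4)).mono ?_
  simp [N]
  omega

/-- A language that is decided by a program, with loops of one round more than the input is long,
belongs to `P`. -/
theorem inP_of_stackProg (p : StackProg S) (src dst out : S) (h : src ≠ dst) (L : Language Bool)
    (hL : ∀ w, w ∈ L ↔
      (exec (w.length + 1) p (Function.update (fun _ => []) dst w.reverse) out).head? =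
        some true) : InP L := by
  classical
  refine ⟨{
    tm := machine p src dst out
    inputAlphabet := Equiv.refl Bool
    outputAlphabet := Equiv.refl Bool
    time := 2 * p.cost.comp (Polynomial.X + 1) + 2 * Polynomial.X + 5
    outputsFun := fun w => Classical.choice ?_ }⟩
  have := gets_machine p src dst out h w
  have e : (decide (w ∈ L)) =
    ((exec (w.length + 1) p (Function.update (fun _ => []) dst w.reverse) out).head?
          == some true) := by
    rw [Bool.eq_iff_iff, decide_eq_true_iff, hL, beq_iff_eq]
  rw [← e] at this
  have single : ∀ (s k : Stacks S (MachineLabel p)) (u : List Bool),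
      @dite (List Bool) (k = s) ((machine p src dst out).kDecidableEq k s) (fun _ => u) (fun _ => [])
        = Function.update (fun _ => []) s u k := by
    intro s k u
    by_cases hk : k = s
    · subst hk; simp
    · simp [hk]
  have e1 : initList (machine p src dst out) w =
      ⟨some (.inl .start), (none, false), Function.update (fun _ => []) (.inl src) w⟩ := by
    simp only [initList]
    congr 1
    funext k
    exact single _ _ _
  have e2 : haltList (machine p src dst out) [decide (w ∈ L)] =
      ⟨none, (none, false), Function.update (fun _ => []) (.inl out) [decide (w ∈ L)]⟩ := by
    simp only [haltList]
    congr 1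
    funext k
    exact single _ _ _
  have e3 : List.map (Equiv.refl Bool).invFun w = w := List.map_id w
  obtain ⟨this⟩ := this
  refine ⟨?_⟩
  have e4 : initList (machine p src dst out) (List.map (Equiv.refl Bool).invFun w) =
      ⟨some (.inl .start), (none, false), Function.update (fun _ => []) (.inl src) w⟩ :=
    (congrArg (initList (machine p src dst out)) e3).trans e1
  refine cast ?_ this
  exact congrArg₂ (fun c c' => EvalsToInTime (TM2.step (machineCode p src dst out)) c (some c') _)
    e4.symm e2.symm

end StackProg

/-! ### Programs on tables -/

/-- Iterates a function that is told the number of the round. -/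
def upTo {α : Type*} (f : ℕ → α → α) : ℕ → α → α
  | 0, s => s
  | n + 1, s => f n (upTo f n s)

theorem upTo_induction {α : Type*} {f : ℕ → α → α} (P : ℕ → α → Prop) {n : ℕ} {s : α}
    (h0 : P 0 s) (h : ∀ i < n, ∀ t, P i t → P (i + 1) (f i t)) : P n (upTo f n s) := by
  have : ∀ m ≤ n, P m (upTo f m s) := by
    intro m
    induction m with
    | zero => exact fun _ => h0
    | succ m ih => exact fun hm => h m (by omega) _ (ih (by omega))
  exact this n le_rfl

/-- Boolean tables with rows and columns indexed by natural numbers, and the rest of the input. -/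
structure Store (A : Type) where
  /-- the tables -/
  tab : A → ℕ → ℕ → Bool
  /-- the part of the input that has not been read -/
  inp : List Bool

/-- Changes one entry of a table. -/
def Store.set {A : Type} [DecidableEq A] (s : Store A) (a : A) (i j : ℕ) (b : Bool) : Store A where
  tab a' i' j' := if a' = a ∧ i' = i ∧ j' = j then b else s.tab a' i' j'
  inp := s.inp

/-- Programs that work on tables. The variables range over the rounds of the loops. -/
inductive TabProg (V A : Type) where
  | skip
  | set (a : A) (x y : V) (b : Bool)
  | ifTab (a : A) (x y : V) (p q : TabProg V A)
  | next (pe pf pt : TabProg V A)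
  | seq (p q : TabProg V A)
  | loop (x : V) (p : TabProg V A)

namespace TabProg

variable {V A : Type} [DecidableEq V] [DecidableEq A]

/-- The effect of a program, the loop variables ranging over the numbers below `N`. -/
def run (N : ℕ) : TabProg V A → (V → ℕ) → Store A → Store A
  | skip, _, s => s
  | set a x y b, ρ, s => s.set a (ρ x) (ρ y) b
  | ifTab a x y p q, ρ, s => if s.tab a (ρ x) (ρ y) = true then run N p ρ s else run N q ρ s
  | next pe pf pt, ρ, s =>
    match s.inp with
    | [] => run N pe ρ s
    | false :: l => run N pf ρ ⟨s.tab, l⟩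
    | true :: l => run N pt ρ ⟨s.tab, l⟩
  | seq p q, ρ, s => run N q ρ (run N p ρ s)
  | loop x p, ρ, s => upTo (fun i s => run N p (Function.update ρ x i) s) N s

/-- No loop uses the variable of a loop that it is part of, nor a variable in `B`. -/
def Scoped : Finset V → TabProg V A → Prop
  | _, skip => True
  | _, set _ _ _ _ => True
  | B, ifTab _ _ _ p q => Scoped B p ∧ Scoped B q
  | B, next pe pf pt => Scoped B pe ∧ Scoped B pf ∧ Scoped B pt
  | B, seq p q => Scoped B p ∧ Scoped B q
  | B, loop x p => x ∉ B ∧ Scoped (insert x B) p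

/-- The tables that a program changes. -/
def writes : TabProg V A → Finset A
  | skip => ∅
  | set a _ _ _ => {a}
  | ifTab _ _ _ p q => writes p ∪ writes q
  | next pe pf pt => writes pe ∪ (writes pf ∪ writes pt)
  | seq p q => writes p ∪ writes q
  | loop _ p => writes p

/-- A frame rule. Since `writes` is computable, its hypothesis is settled by `decide` for concrete
programs. -/
theorem run_tab_of_notMem (N : ℕ) (p : TabProg V A) {a : A} (h : a ∉ p.writes) (ρ : V → ℕ)
    (s : Store A) : (p.run N ρ s).tab a = s.tab a := by
  induction p generalizing ρ s with
  | skip => rfl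
  | set b x y c =>
    have : a ≠ b := by simpa [writes] using h
    funext i j
    simp [run, Store.set, this]
  | ifTab b x y p q ihp ihq =>
    simp only [writes, Finset.mem_union, not_or] at h
    simp only [run]
    split
    · exact ihp h.1 ρ s
    · exact ihq h.2 ρ s
  | next pe pf pt ihe ihf iht =>
    simp only [writes, Finset.mem_union, not_or] at h
    simp only [run]
    split
    · exact ihe h.1 ρ s
    · exact ihf h.2.1 ρ _
    · exact iht h.2.2 ρ _
  | seq p q ihp ihq =>
    simp only [writes, Finset.mem_union, not_or] at h
    simp only [run]
    rw [ihq h.2, ihp h.1]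
  | loop x p ih =>
    exact upTo_induction (fun _ t => t.tab a = s.tab a) rfl
      fun i _ t ht => (ih h _ t).trans ht

/-- All entries of the tables outside the first `N` rows and columns are `false`. -/
def _root_.GraphUnfrozen.Store.Small {A : Type} (N : ℕ) (s : Store A) : Prop :=
  ∀ a i j, s.tab a i j = true → i < N ∧ j < N

/-- Loops reach only indices below `N`, whereas invariants such as `Valid` speak of all natural
numbers; the entries beyond are known to be `false` by this lemma. -/
theorem run_small (N : ℕ) (p : TabProg V A) (ρ : V → ℕ) (hρ : ∀ x, ρ x < N)
    (s : Store A) (hs : s.Small N) : (p.run N ρ s).Small N := by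
  induction p generalizing ρ s with
  | skip => exact hs
  | set b x y c =>
    intro a i j h
    simp only [run, Store.set] at h
    split at h
    next he => rw [he.2.1, he.2.2]; exact ⟨hρ x, hρ y⟩
    next => exact hs a i j h
  | ifTab b x y p q ihp ihq =>
    simp only [run]
    split
    · exact ihp ρ hρ s hs
    · exact ihq ρ hρ s hs
  | next pe pf pt ihe ihf iht =>
    simp only [run]
    split
    · exact ihe ρ hρ s hs
    · exact ihf ρ hρ _ hs
    · exact iht ρ hρ _ hs
  | seq p q ihp ihq => exact ihq ρ hρ _ (ihp ρ hρ s hs)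
  | loop x p ih =>
    refine upTo_induction (fun _ t => t.Small N) hs fun i hi t ht => ih _ (fun y => ?_) t ht
    by_cases hy : y = x
    · subst hy; simpa using hi
    · simpa [hy] using hρ y

/-! ### Compilation of table programs to stack programs -/

/-- The stacks by which tables and variables are represented. -/
inductive Name (V A : Type) where
  | source | word | input | scratch | count
  | var (x : V)
  | arr (a : A)
  deriving DecidableEq

instance [Finite V] [Finite A] : Finite (Name V A) :=
  Finite.of_surjective (fun x : Fin 5 ⊕ V ⊕ A => match x with
    | .inl 0 => .source
    | .inl 1 => .word
    | .inl 2 => .input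
    | .inl 3 => .scratch
    | .inl 4 => .count
    | .inr (.inl x) => .var x
    | .inr (.inr a) => .arr a) fun k => by cases k <;> simp [Fin.exists_fin_succ]

open StackProg

/-- A table as a list, row by row. -/
def tabList (N : ℕ) (f : ℕ → ℕ → Bool) : List Bool :=
  (List.range (N * N)).map fun c => f (c / N) (c % N)

/-- The stacks that represent tables and variables. -/
def layout (N : ℕ) (ρ : V → ℕ) (s : Store A) : Name V A → List Bool
  | .input => s.inp
  | .var x => List.replicate (ρ x) true
  | .arr a => tabList N (s.tab a)
  | _ => []

/-- Moves the top of one stack to another. -/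
def move (k k' : Name V A) : StackProg (Name V A) :=
  .ifTop k .skip (.seq (.pop k) (.push k' false)) (.seq (.pop k) (.push k' true))

/-- The number `n` may exceed the height of the stack `k`: moving from an empty stack does nothing,
in accordance with `drop` and `take`. -/
theorem exec_move_iterate (N : ℕ) {k k' : Name V A} (h : k ≠ k') (n : ℕ)
    (T : Name V A → List Bool) : (exec N (move k k'))^[n] T =
      Function.update (Function.update T k ((T k).drop n)) k'
        (((T k).take n).reverse ++ T k') := by
  induction n generalizing T with
  | zero => simp
  | succ n ih =>
    rw [Function.iterate_succ_apply, ih]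
    rcases hT : T k with - | ⟨b, l⟩
    · have : exec N (move k k') T = T := by simp [move, exec, hT]
      rw [this, hT]
      simp
    · have : exec N (move k k') T = Function.update (Function.update T k l) k' (b :: T k') := by
        cases b <;> simp [move, exec, hT, h.symm]
      rw [this, Function.update_of_ne h, Function.update_self, Function.update_self]
      simp only [Function.update_comm h, Function.update_idem, List.drop_succ_cons,
        List.take_succ_cons, List.reverse_cons, List.append_assoc, List.singleton_append]

theorem exec_move_update (N : ℕ) {k k' x : Name V A} (h : x ≠ k) (h' : x ≠ k') (n : ℕ)
    (T : Name V A → List Bool) (l : List Bool) (hk : k ≠ k') :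
    (exec N (move k k'))^[n] (Function.update T x l) =
      Function.update ((exec N (move k k'))^[n] T) x l := by
  rw [exec_move_iterate N hk, exec_move_iterate N hk, Function.update_of_ne h.symm,
    Function.update_of_ne h'.symm, Function.update_comm h, Function.update_comm h']

/-- Runs the body as often as the variable tells. -/
def times (x : V) (body : StackProg (Name V A)) : StackProg (Name V A) :=
  .seq (.rep (.ifTop (.var x) .skip .skip (.seq (.seq (.pop (.var x)) (.push .count true)) body)))
    (.rep (move .count (.var x)))

/-- The unary value of `x` is used up symbol by symbol, each round running the body once, and is
saved on `count`, from which it is restored. The bodies needed are just repeated moves, which leave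
both stacks alone. -/
theorem exec_times (N c m : ℕ) (hm : m ≤ N) (x : V) (a : A) (body : StackProg (Name V A))
    (hb : ∀ T, exec N body T = (exec N (move (.arr a) .scratch))^[c] T) (T : Name V A → List Bool)
    (hx : T (.var x) = List.replicate m true) (hc : T .count = []) :
    exec N (times x body) T = (exec N (move (.arr a) .scratch))^[c * m] T := by
  let step := StackProg.ifTop (Name.var x) .skip .skip
    (.seq (.seq (.pop (.var x)) (.push .count true)) body)
  let F := exec N (move (V := V) (.arr a) .scratch)
  let U : ℕ → Name V A → List Bool := fun j => Function.update (Function.update (F^[c * j] T)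
    (.var x) (List.replicate (m - j) true)) .count (List.replicate j true)
  have hF : ∀ n T (k : Name V A), k ≠ .arr a → k ≠ .scratch → F^[n] T k = T k := by
    intro n T k h h'
    simp only [F]
    rw [exec_move_iterate N (by simp), Function.update_of_ne h', Function.update_of_ne h]
  have h1 : ∀ j ≤ m, (exec N step)^[j] T = U j := by
    intro j
    induction j with
    | zero =>
      intro _
      simp only [U, Function.iterate_zero, id_eq, mul_zero, Nat.sub_zero, List.replicate_zero]
      rw [← hx, Function.update_eq_self, ← hc, Function.update_eq_self]
    | succ j ih =>
      intro hj
      rw [Function.iterate_succ_apply', ih (by omega)]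
      have e : m - j = m - (j + 1) + 1 := by omega
      have hU : U j (.var x) = true :: List.replicate (m - (j + 1)) true := by
        simp [U, e, List.replicate_succ]
      simp only [step, exec, hU, List.head?_cons, hb, List.tail_cons]
      simp only [U]
      rw [exec_move_update N (by simp) (by simp) _ _ _ (by simp),
        exec_move_update N (by simp) (by simp) _ _ _ (by simp),
        exec_move_update N (by simp) (by simp) _ _ _ (by simp),
        exec_move_update N (by simp) (by simp) _ _ _ (by simp)]
      rw [← Function.iterate_add_apply, show c + c * j = c * (j + 1) by ring]
      funext k
      by_cases hk : k = .count
      · subst hk; simp [List.replicate_succ]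
      · by_cases hk' : k = .var x
        · subst hk'; simp
        · simp [hk, hk', F]
  -- The loop makes `N` rounds whatever `m` is; those after the first `m` find the variable empty
  -- and are idle.
  have h2 : ∀ n, (exec N step)^[n] (U m) = U m := by
    intro n
    refine Function.iterate_fixed ?_ n
    simp [step, exec, U]
  have h3 : (exec N step)^[N] T = U m := by
    obtain ⟨d, rfl⟩ := Nat.exists_eq_add_of_le' hm
    rw [Function.iterate_add_apply, h1 m le_rfl, h2]
  change (exec N (move .count (.var x)))^[N] ((exec N step)^[N] T) = _
  rw [h3, exec_move_iterate N (by simp)]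
  funext k
  by_cases hk : k = .var x
  · subst hk
    have := hF (c * m) T (.var x) (by simp) (by simp)
    simp only [F] at this
    simp [U, this, hx, hm]
  · by_cases hk' : k = .count
    · subst hk'
      have := hF (c * m) T .count (by simp) (by simp)
      simp only [F] at this
      simp [U, this, hc, hm]
    · simp [hk, hk', U, F]

/-- Moves the part of a table in front of an entry out of the way. -/
def seek (a : A) (x y : V) : StackProg (Name V A) :=
  .seq (times x (.rep (move (.arr a) .scratch))) (times y (move (.arr a) .scratch))

/-- Moves back what is out of the way. -/
def unseek (a : A) : StackProg (Name V A) := .rep (.rep (move .scratch (.arr a)))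

/-- Row by row, the entry `(i, j)` is preceded by `N * i + j` others: `i` times `N` symbols and then
`j` single ones are moved away, and the entry lies on top. -/
theorem exec_seek (N : ℕ) (ρ : V → ℕ) (hρ : ∀ x, ρ x < N) (s : Store A) (a : A) (x y : V) :
    exec N (seek a x y) (layout N ρ s) =
      Function.update (Function.update (layout N ρ s) (.arr a)
        ((tabList N (s.tab a)).drop (N * ρ x + ρ y))) .scratch
        ((tabList N (s.tab a)).take (N * ρ x + ρ y)).reverse := by
  have h1 := exec_times N N (ρ x) (hρ x).le x a (.rep (move (.arr a) .scratch)) (fun _ => rfl)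
    (layout N ρ s) rfl rfl
  have h2 := exec_times N 1 (ρ y) (hρ y).le y a (move (.arr a) .scratch) (fun _ => rfl)
    ((exec N (move (.arr a) .scratch))^[N * ρ x] (layout N ρ s))
    (by rw [exec_move_iterate N (by simp)]; simp [layout])
    (by rw [exec_move_iterate N (by simp)]; simp [layout])
  rw [seek, exec, h1, h2, one_mul, ← Function.iterate_add_apply, exec_move_iterate N (by simp),
    add_comm (ρ y)]
  simp [layout]

/-- It need not be known how many symbols were moved away: `N * N` moves bring back a whole table,
and superfluous ones are idle. -/
theorem exec_unseek (N : ℕ) (a : A) (T : Name V A → List Bool) (h : (T .scratch).length ≤ N * N) :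
    exec N (unseek a) T = Function.update (Function.update T .scratch []) (.arr a)
      ((T .scratch).reverse ++ T (.arr a)) := by
  have : exec N (unseek a) T = (exec N (move .scratch (.arr a)))^[N * N] T := by
    simp only [unseek, exec]
    rw [Function.iterate_mul]
  rw [this, exec_move_iterate N (by simp), List.drop_of_length_le h, List.take_of_length_le h]

theorem length_tabList (N : ℕ) (f : ℕ → ℕ → Bool) : (tabList N f).length = N * N := by
  simp [tabList]

theorem index_lt {N i j : ℕ} (hi : i < N) (hj : j < N) : N * i + j < N * N := by
  have : N * i + N ≤ N * N := by
    calc N * i + N = N * (i + 1) := by ring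
      _ ≤ N * N := Nat.mul_le_mul_left _ hi
  omega

theorem tabList_getElem? {N i j : ℕ} (f : ℕ → ℕ → Bool) (hi : i < N) (hj : j < N) :
    (tabList N f)[N * i + j]? = some (f i j) := by
  have h := index_lt hi hj
  have hN : 0 < N := by omega
  simp [tabList, h, Nat.mul_add_div hN, Nat.div_eq_of_lt hj, Nat.mod_eq_of_lt hj]

theorem tabList_set {N i j : ℕ} (s : Store A) (a : A) (b : Bool) (hi : i < N) (hj : j < N) :
    tabList N ((s.set a i j b).tab a) = (tabList N (s.tab a)).set (N * i + j) b := by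
  have hN : 0 < N := by omega
  refine List.ext_getElem (by simp [length_tabList]) fun c h1 h2 => ?_
  rw [length_tabList] at h1
  rw [List.getElem_set]
  simp only [tabList, Store.set, List.getElem_map, List.getElem_range, true_and]
  by_cases hc : N * i + j = c
  · subst hc
    simp [Nat.mul_add_div hN, Nat.div_eq_of_lt hj, Nat.mod_eq_of_lt hj]
  · rw [if_neg hc, if_neg]
    rintro ⟨rfl, rfl⟩
    exact hc (Nat.div_add_mod c N)

/-- The program on stacks that carries out a program on tables. -/
def toStack : TabProg V A → StackProg (Name V A)
  | skip => .skip
  | set a x y b => .seq (seek a x y) (.seq (.seq (.pop (.arr a)) (.push (.arr a) b)) (unseek a))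
  | ifTab a x y p q =>
    .seq (seek a x y)
      (.ifTop (.arr a) .skip (.seq (unseek a) (toStack q)) (.seq (unseek a) (toStack p)))
  | next pe pf pt =>
    .ifTop .input (toStack pe) (.seq (.pop .input) (toStack pf)) (.seq (.pop .input) (toStack pt))
  | seq p q => .seq (toStack p) (toStack q)
  | loop x p =>
    .seq (.rep (.seq (toStack p) (.push (.var x) true))) (.rep (.pop (.var x)))

theorem layout_update_var (N : ℕ) (ρ : V → ℕ) (s : Store A) (x : V) (i : ℕ) :
    layout N (Function.update ρ x i) s =
      Function.update (layout N ρ s) (.var x) (List.replicate i true) := by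
  funext k
  cases k with
  | var y =>
    by_cases h : y = x
    · subst h; simp [layout]
    · simp [layout, h]
  | _ => simp [layout]

theorem exec_toStack_set (N : ℕ) (a : A) (x y : V) (b : Bool) (ρ : V → ℕ) (hρ : ∀ x, ρ x < N)
    (s : Store A) : exec N (toStack (.set a x y b)) (layout N ρ s) =
      layout N ρ (s.set a (ρ x) (ρ y) b) := by
  have hc := index_lt (hρ x) (hρ y)
  have hl := length_tabList N (s.tab a)
  simp only [toStack, exec]
  rw [exec_seek N ρ hρ, exec_unseek]
  · funext k
    by_cases hk : k = .arr a
    · subst hk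
      simp only [ne_eq, reduceCtorEq, not_false_eq_true, Function.update_of_ne,
        Function.update_self, List.reverse_reverse, layout]
      rw [tabList_set s a b (hρ x) (hρ y), List.set_eq_take_append_cons_drop,
        if_pos (by rw [hl]; exact hc)]
      simp [List.tail_drop]
    · by_cases hk' : k = .scratch
      · subst hk'
        simp [layout]
      · cases k with
        | arr a' =>
          have ha : a' ≠ a := fun h => hk (by rw [h])
          simp [layout, hk, Store.set, ha]
        | _ => simp_all [layout, Store.set]
  · simp [hl]

theorem exec_toStack_ifTab (N : ℕ) (a : A) (x y : V) (p q : TabProg V A) (ρ : V → ℕ)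
    (hρ : ∀ x, ρ x < N) (s : Store A) : exec N (toStack (.ifTab a x y p q)) (layout N ρ s) =
      if s.tab a (ρ x) (ρ y) = true then exec N (toStack p) (layout N ρ s)
      else exec N (toStack q) (layout N ρ s) := by
  have hc := index_lt (hρ x) (hρ y)
  have hl := length_tabList N (s.tab a)
  have back : exec N (unseek a) (Function.update (Function.update (layout N ρ s) (.arr a)
        ((tabList N (s.tab a)).drop (N * ρ x + ρ y))) .scratch
        ((tabList N (s.tab a)).take (N * ρ x + ρ y)).reverse) = layout N ρ s := by
    rw [exec_unseek]
    · funext k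
      by_cases hk : k = .arr a
      · subst hk
        simp [layout]
      · by_cases hk' : k = .scratch
        · subst hk'
          simp [layout]
        · simp [hk, hk']
    · simp [hl]
  simp only [toStack, exec]
  rw [exec_seek N ρ hρ, back]
  have : ((tabList N (s.tab a)).drop (N * ρ x + ρ y)).head? = some (s.tab a (ρ x) (ρ y)) := by
    rw [List.head?_drop, tabList_getElem? _ (hρ x) (hρ y)]
  rw [Function.update_of_ne (by simp), Function.update_self, this]
  cases s.tab a (ρ x) (ρ y) <;> simp

theorem exec_pop_iterate (N : ℕ) (k : Name V A) (T : Name V A → List Bool) (n : ℕ) :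
    (exec N (.pop k))^[n] T = Function.update T k ((T k).drop n) := by
  induction n with
  | zero => simp
  | succ n ih =>
    rw [Function.iterate_succ_apply', ih]
    simp [exec]

/-- A loop represents its variable by a stack that starts empty and receives one symbol per round.
This requires the variable to be `0` at the entry, which is why `Scoped` forbids the reuse of the
variable of an enclosing loop: only variables in `B` may be nonzero. -/
theorem exec_toStack (N : ℕ) (p : TabProg V A) (B : Finset V) (hp : p.Scoped B) (ρ : V → ℕ)
    (hρ : ∀ x, ρ x < N) (hB : ∀ x ∉ B, ρ x = 0) (s : Store A) :
    exec N p.toStack (layout N ρ s) = layout N ρ (p.run N ρ s) := by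
  induction p generalizing B ρ s with
  | skip => rfl
  | set a x y b => exact exec_toStack_set N a x y b ρ hρ s
  | ifTab a x y p q ihp ihq =>
    rw [exec_toStack_ifTab N a x y p q ρ hρ s, ihp B hp.1 ρ hρ hB, ihq B hp.2 ρ hρ hB]
    simp only [run]
    split <;> rfl
  | next pe pf pt ihe ihf iht =>
    have hpop : ∀ b l, s.inp = b :: l →
        Function.update (layout N ρ s) .input (layout N ρ s .input).tail =
          layout N ρ ⟨s.tab, l⟩ := by
      intro b l h
      funext k
      cases k <;> simp [layout, h]
    rcases h : s.inp with - | ⟨- | -, l⟩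
    · simpa [toStack, exec, layout, h, run] using ihe B hp.1 ρ hρ hB s
    · have : (layout N ρ s .input).head? = some false := by simp [layout, h]
      simp only [toStack, exec, this, hpop _ _ h, run, h]
      exact ihf B hp.2.1 ρ hρ hB _
    · have : (layout N ρ s .input).head? = some true := by simp [layout, h]
      simp only [toStack, exec, this, hpop _ _ h, run, h]
      exact iht B hp.2.2 ρ hρ hB _
  | seq p q ihp ihq =>
    simp only [toStack, exec, run]
    rw [ihp B hp.1 ρ hρ hB, ihq B hp.2 ρ hρ hB]
  | loop x p ih =>
    have hx : ρ x = 0 := hB x hp.1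
    have key : ∀ n ≤ N, (exec N (.seq (toStack p) (.push (.var x) true)))^[n] (layout N ρ s) =
        layout N (Function.update ρ x n)
          (upTo (fun i s => run N p (Function.update ρ x i) s) n s) := by
      intro n
      induction n with
      | zero =>
        intro _
        rw [← hx, Function.update_eq_self, hx]
        rfl
      | succ n ihn =>
        intro hn
        rw [Function.iterate_succ_apply', ihn (by omega), exec,
          ih (insert x B) hp.2 (Function.update ρ x n)]
        · simp only [exec, upTo]
          rw [layout_update_var, layout_update_var]
          simp [List.replicate_succ]
        · intro y
          by_cases hy : y = x
          · subst hy; simpa using hn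
          · simpa [hy] using hρ y
        · intro y hy
          rw [Finset.mem_insert, not_or] at hy
          simpa [hy.1] using hB y hy.2
    change (exec N (.pop (.var x)))^[N]
      ((exec N (.seq (toStack p) (.push (.var x) true)))^[N] (layout N ρ s)) = _
    -- After `N` rounds the variable has the value `N`, and `N` pops reset it to `0`.
    rw [key N le_rfl, exec_pop_iterate, run, layout_update_var,
      Function.update_idem, Function.update_self, List.drop_of_length_le (by simp)]
    have : ([] : List Bool) = List.replicate (ρ x) true := by rw [hx]; rfl
    rw [this, ← layout_update_var, Function.update_eq_self]

/-- Pushes one symbol on the stacks of all tables in a list. -/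
def pushTabs (L : List A) : StackProg (Name V A) :=
  L.foldr (fun a p => .seq (.push (.arr a) false) p) .skip

theorem exec_pushTabs (N : ℕ) (L : List A) (hL : L.Nodup) (T T' : Name V A → List Bool)
    (h : ∀ a ∈ L, T' (.arr a) = false :: T (.arr a)) (h' : ∀ k, (∀ a ∈ L, k ≠ .arr a) → T' k = T k) :
    exec N (pushTabs L) T = T' := by
  induction L generalizing T with
  | nil => exact funext fun k => (h' k (by simp)).symm
  | cons a L ih =>
    obtain ⟨ha, hL⟩ := List.nodup_cons.1 hL
    have e : pushTabs (V := V) (a :: L) = .seq (.push (.arr a) false) (pushTabs L) := rfl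
    rw [e, exec, exec]
    refine ih hL _ (fun b hb => ?_) fun k hk => ?_
    · have : b ≠ a := by rintro rfl; exact ha hb
      simp [h b (by simp [hb]), this]
    · by_cases hka : k = .arr a
      · subst hka; simp [h a]
      · rw [Function.update_of_ne hka]
        refine h' k fun b hb => ?_
        rcases List.mem_cons.1 hb with rfl | hb
        · exact hka
        · exact hk b hb

/-- Puts the word in order, and clears the tables. -/
noncomputable def prepare [Fintype A] : StackProg (Name V A) :=
  .seq (.rep (move .word .input)) (.rep (.rep (pushTabs Finset.univ.toList)))

/-- Loading has reversed the word, and moving it once more puts it right. Cleared tables are lists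
of `N * N` symbols `false`, pushed by two nested loops. -/
theorem exec_prepare [Fintype A] (w : List Bool) :
    exec (w.length + 1) (prepare (V := V) (A := A))
      (Function.update (fun _ => []) .word w.reverse) =
      layout (w.length + 1) (fun _ => 0) ⟨fun _ _ _ => false, w⟩ := by
  set N := w.length + 1
  let R : ℕ → Name V A → List Bool := fun n k => match k with
    | .input => w
    | .arr _ => List.replicate n false
    | _ => []
  have h1 : exec N (.rep (move .word .input))
      (Function.update (fun _ : Name V A => []) .word w.reverse) = R 0 := by
    rw [exec, exec_move_iterate N (by simp)]
    funext k
    cases k <;> simp [R, N, List.drop_of_length_le, List.take_of_length_le]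
  have h2 : ∀ n, exec N (pushTabs Finset.univ.toList) (R n) = R (n + 1) := by
    intro n
    refine exec_pushTabs N _ (Finset.nodup_toList _) _ _ (by simp [R, List.replicate_succ]) ?_
    intro k hk
    cases k with
    | arr a => exact absurd rfl (hk a (by simp))
    | _ => rfl
  have h3 : ∀ m n, (exec N (pushTabs Finset.univ.toList))^[m] (R n) = R (n + m) := by
    intro m
    induction m with
    | zero => intro n; rfl
    | succ m ih =>
      intro n
      rw [Function.iterate_succ_apply, h2, ih, show n + 1 + m = n + (m + 1) by omega]
  have h4 : exec N (.rep (.rep (pushTabs Finset.univ.toList))) (R 0) = R (N * N) := by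
    simp only [exec]
    rw [← Function.iterate_mul, h3, zero_add]
  rw [prepare, exec, h1, h4]
  funext k
  cases k <;> simp [R, layout, tabList]

/-- A language that is decided by a program on tables belongs to `P`. -/
theorem inP_of_tabProg [Fintype V] [Fintype A] (p : TabProg V A) (hp : p.Scoped ∅) (out : A)
    (L : Language Bool) (hL : ∀ w, w ∈ L ↔
      (p.run (w.length + 1) (fun _ => 0) ⟨fun _ _ _ => false, w⟩).tab out 0 0 = true) :
    InP L := by
  classical
  let _ : Fintype (Name V A) := Fintype.ofFinite _
  refine inP_of_stackProg (.seq prepare p.toStack) .source .word (.arr out) (by simp) L fun w => ?_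
  rw [hL, exec, exec_prepare,
    exec_toStack (w.length + 1) p ∅ hp _ (fun _ => Nat.succ_pos _) (fun _ _ => rfl)]
  have := tabList_getElem? ((p.run (w.length + 1) (fun _ => 0) ⟨fun _ _ _ => false, w⟩).tab out)
    (Nat.succ_pos w.length) (Nat.succ_pos w.length)
  rw [mul_zero, add_zero] at this
  rw [layout, List.head?_eq_getElem?, this]
  simp

end TabProg

/-! ### Matchings and covers by an auction -/

/-- The tables used to decide the problems. -/
inductive Tab where
  | vert | adj | even | mat | free | prev | price | crit | ended | err | ok
  deriving DecidableEq

instance : Fintype Tab :=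
  ⟨{.vert, .adj, .even, .mat, .free, .prev, .price, .crit, .ended, .err, .ok},
    fun t => by cases t <;> simp⟩

@[ext]
theorem Store.ext {A : Type} {s t : Store A} (h : ∀ a i j, s.tab a i j = t.tab a i j)
    (h' : s.inp = t.inp) : s = t := by
  cases s
  cases t
  congr
  funext a i j
  exact h a i j

/-- Sets `L` and `R` of left and right vertices that cover all edges at the left vertices with the
property `act`. -/
def IsBicover (G : ℕ → ℕ → Bool) (act : ℕ → Prop) (L R : Finset ℕ) : Prop :=
  ∀ l r, act l → G l r = true → l ∈ L ∨ r ∈ R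

/-- The least size of a cover of the edges at the left vertices with the property `act`. -/
noncomputable def coverNum (G : ℕ → ℕ → Bool) (act : ℕ → Prop) : ℕ :=
  sInf {c | ∃ L R, IsBicover G act L R ∧ L.card + R.card = c}

/-- The state of an auction in which the left vertices bid for the right vertices. The table `mat`
is a matching, `free` has the left vertices that may bid on its diagonal, and `price r k` tells that
the price of `r` exceeds `k`. -/
structure Valid (N : ℕ) (G : ℕ → ℕ → Bool) (act : ℕ → Prop) (s : Store Tab) : Prop where
  adj_eq : s.tab .adj = G
  sub : ∀ {l r}, s.tab .mat l r = true → G l r = true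
  left : ∀ {l r r'}, s.tab .mat l r = true → s.tab .mat l r' = true → r = r'
  right : ∀ {l l' r}, s.tab .mat l r = true → s.tab .mat l' r = true → l = l'
  matched_iff : ∀ l < N, (∃ r, s.tab .mat l r = true) ↔ act l ∧ s.tab .free l l = false
  act_of_free : ∀ l < N, s.tab .free l l = true → act l
  down : ∀ {r k k'}, s.tab .price r k = true → k' ≤ k → s.tab .price r k' = true
  sold : ∀ {r k}, s.tab .price r k = true → ∃ l, s.tab .mat l r = true
  happy : ∀ {l r r' k k'}, s.tab .mat l r = true → s.tab .price r k = true → k' < k →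
    G l r' = true → s.tab .price r' k' = true

/-- The left vertex `l` gets the right vertex `r` and raises its price above `k`. -/
def Store.bid (s : Store Tab) (l r k : ℕ) : Store Tab where
  tab t a b := match t with
    | .mat => if b = r then decide (a = l) else s.tab .mat a b
    | .free => if a = b then (if a = l then false else s.tab .mat a r || s.tab .free a b)
        else s.tab .free a b
    | .price => if a = r ∧ b = k then true else s.tab .price a b
    | t => s.tab t a b
  inp := s.inp

/-- By `hk` and `hp` the vertex `r` has price exactly `k` and is a cheapest neighbour of `l`. After
the bid it costs `k + 1`, at most one more than any neighbour of `l`, which is what `happy` demands.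
Other matched vertices keep their partners, and no price falls; the former owner of `r` becomes
free. -/
theorem Valid.bid {N : ℕ} {G : ℕ → ℕ → Bool} {act : ℕ → Prop} {s : Store Tab} (h : Valid N G act s)
    {l r k : ℕ} (hl : l < N) (hf : s.tab .free l l = true) (hG : G l r = true)
    (hk : ∀ r', G l r' = true → ∀ k' < k, s.tab .price r' k' = true)
    (hp : s.tab .price r k = false) : Valid N G act (s.bid l r k) := by
  have hlu : ∀ r', s.tab .mat l r' = false := by
    intro r'
    by_contra hc
    have := ((h.matched_iff l hl).1 ⟨r', by simpa using hc⟩).2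
    simp [hf] at this
  have mono : ∀ a b, s.tab .price a b = true → (s.bid l r k).tab .price a b = true := by
    intro a b hab
    simp [Store.bid, hab]
  have lt_of : ∀ b, s.tab .price r b = true → b < k := by
    intro b hb
    by_contra hc
    have := h.down hb (not_lt.1 hc)
    simp [hp] at this
  refine ⟨h.adj_eq, ?_, ?_, ?_, ?_, ?_, ?_, ?_, ?_⟩
  · intro a b hab
    by_cases hb : b = r
    · subst hb
      have : a = l := by simpa [Store.bid] using hab
      rw [this, hG]
    · exact h.sub (by simpa [Store.bid, hb] using hab)
  · intro a b b' hab hab'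
    by_cases ha : a = l
    · subst ha
      simp only [Store.bid, decide_true, hlu, Bool.if_false_right, Bool.and_true,
        decide_eq_true_eq] at hab hab'
      rw [hab, hab']
    · have hb : b ≠ r := by rintro rfl; simp [Store.bid, ha] at hab
      have hb' : b' ≠ r := by rintro rfl; simp [Store.bid, ha] at hab'
      exact h.left (by simpa [Store.bid, hb] using hab) (by simpa [Store.bid, hb'] using hab')
  · intro a a' b hab hab'
    by_cases hb : b = r
    · subst hb
      have h1 : a = l := by simpa [Store.bid] using hab
      have h2 : a' = l := by simpa [Store.bid] using hab'
      rw [h1, h2]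
    · exact h.right (by simpa [Store.bid, hb] using hab) (by simpa [Store.bid, hb] using hab')
  · intro a ha
    by_cases hal : a = l
    · subst hal
      constructor
      · exact fun _ => ⟨h.act_of_free a ha hf, by simp [Store.bid]⟩
      · exact fun _ => ⟨r, by simp [Store.bid]⟩
    · have e := h.matched_iff a ha
      by_cases hm : s.tab .mat a r = true
      · constructor
        · rintro ⟨b, hb⟩
          have hbr : b ≠ r := by rintro rfl; simp [Store.bid, hal] at hb
          exact absurd (h.left hm (by simpa [Store.bid, hbr] using hb)) hbr.symm
        · rintro ⟨-, hb⟩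
          simp [Store.bid, hal, hm] at hb
      · have e1 : (∃ b, (s.bid l r k).tab .mat a b = true) ↔ ∃ b, s.tab .mat a b = true := by
          refine exists_congr fun b => ?_
          by_cases hb : b = r
          · subst hb; simp [Store.bid, hal, hm]
          · simp [Store.bid, hb]
        rw [e1, e]
        simp [Store.bid, hal, hm]
  · intro a ha hfa
    by_cases hal : a = l
    · subst hal; exact h.act_of_free a ha hf
    · by_cases hm : s.tab .mat a r = true
      · exact ((h.matched_iff a ha).1 ⟨r, hm⟩).1
      · exact h.act_of_free a ha (by simpa [Store.bid, hal, hm] using hfa)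
  · intro a b b' hab hb'
    by_cases hc : a = r ∧ b = k
    · obtain ⟨rfl, rfl⟩ := hc
      rcases hb'.lt_or_eq with hlt | rfl
      · exact mono _ _ (hk _ hG _ hlt)
      · exact hab
    · exact mono _ _ (h.down (by simpa [Store.bid, hc] using hab) hb')
  · intro a b hab
    by_cases ha : a = r
    · exact ⟨l, by simp [Store.bid, ha]⟩
    · obtain ⟨a', ha'⟩ := h.sold (r := a) (k := b) (by simpa [Store.bid, ha] using hab)
      exact ⟨a', by simp [Store.bid, ha, ha']⟩
  · intro a b b' c c' hab hbc hc hG'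
    apply mono
    by_cases hb : b = r
    · subst hb
      have : a = l := by simpa [Store.bid] using hab
      subst this
      refine hk _ hG' _ (hc.trans_le ?_)
      by_cases hck : c = k
      · exact hck.le
      · exact (lt_of c (by simpa [Store.bid, hck] using hbc)).le
    · exact h.happy (by simpa [Store.bid, hb] using hab) (by simpa [Store.bid, hb] using hbc) hc hG'

/-- A left vertex that can bid but finds no right vertex that is cheap enough. -/
def GivenUp (N : ℕ) (G : ℕ → ℕ → Bool) (s : Store Tab) (l : ℕ) : Prop :=
  s.tab .free l l = true ∧ ∀ r, G l r = true → ∀ k < N, s.tab .price r k = true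

/-- In the end of an auction, the matched vertices are as many as a least cover has. -/
theorem Valid.coverNum_eq {n N : ℕ} {G : ℕ → ℕ → Bool} {act : ℕ → Prop} [DecidablePred act]
    {s : Store Tab} (h : Valid N G act s) (hn : n + 1 < N)
    (hG : ∀ l r, G l r = true → l < n ∧ r < n)
    (hs : ∀ l < N, s.tab .free l l = true → GivenUp N G s l) :
    coverNum G act = ((Finset.range N).filter fun l => act l ∧ s.tab .free l l = false).card := by
  classical
  set m := (Finset.range N).filter fun l => act l ∧ s.tab .free l l = false with hm
  have mem : ∀ l, l ∈ m ↔ ∃ r, s.tab .mat l r = true := by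
    intro l
    rw [hm, Finset.mem_filter, Finset.mem_range]
    constructor
    · rintro ⟨h1, h2⟩
      exact (h.matched_iff l h1).2 h2
    · rintro ⟨r, hr⟩
      have : l < N := by have := (hG _ _ (h.sub hr)).1; omega
      exact ⟨this, (h.matched_iff l this).1 ⟨r, hr⟩⟩
  choose! p hp using fun l => (mem l).1
  -- a level of prices that does not occur
  obtain ⟨j, hj, hgap⟩ : ∃ j, j + 1 < N ∧
      ∀ r, s.tab .price r j = true → s.tab .price r (j + 1) = true := by
    by_contra hc
    -- Otherwise for each `i < N - 1` some vertex `q i` has price exactly `i + 1`. These vertices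
    -- are distinct and, having been sold, smaller than `n`; but `N - 1 > n`.
    push Not at hc
    choose! q hq hq' using hc
    have hinj : Set.InjOn q (Finset.range (N - 1) : Finset ℕ) := by
      intro i hi j hj hij
      simp only [Finset.coe_range, Set.mem_Iio] at hi hj
      have key : ∀ i j, i + 1 < N → j + 1 < N → q i = q j → ¬ i < j := by
        intro i j hi hj hij hlt
        have := h.down (hq j hj) (show i + 1 ≤ j from hlt)
        rw [← hij] at this
        exact hq' i hi this
      have h1 := key i j (by omega) (by omega) hij
      have h2 := key j i (by omega) (by omega) hij.symm
      omega
    have := Finset.card_le_card_of_injOn (t := Finset.range n) q (fun i hi => by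
      simp only [Finset.coe_range, Set.mem_Iio] at hi ⊢
      obtain ⟨l, hl⟩ := h.sold (hq i (by omega))
      exact (hG _ _ (h.sub hl)).2) hinj
    simp at this
    omega
  have least : IsLeast {c | ∃ L R, IsBicover G act L R ∧ L.card + R.card = c} m.card := by
    constructor
    · let L := m.filter fun l => s.tab .price (p l) j = false
      let R := (m.filter fun l => ¬ s.tab .price (p l) j = false).image p
      have hpinj : Set.InjOn p m := by
        intro a ha b hb hab
        exact h.right (hp a ha) (hab ▸ hp b hb)
      refine ⟨L, R, ?_, ?_⟩
      · intro l r hl hlr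
        by_cases hr : s.tab .price r j = true
        · right
          obtain ⟨a, ha⟩ := h.sold hr
          have ham := (mem a).2 ⟨r, ha⟩
          have : p a = r := h.left (hp a ham) ha
          exact Finset.mem_image.2 ⟨a, by simp [ham, this, hr], this⟩
        · left
          have hlN : l < N := by have := (hG _ _ hlr).1; omega
          have hfree : s.tab .free l l = false := by
            by_contra hc
            exact hr ((hs l hlN (by simpa using hc)).2 r hlr j (by omega))
          have hlm : l ∈ m := by simp [hm, hlN, hl, hfree]
          refine Finset.mem_filter.2 ⟨hlm, ?_⟩
          by_contra hc
          -- If the partner of `l` costs more than `j`, then by the gap it costs more than `j + 1`,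
          -- so every neighbour of `l` costs more than `j`.
          exact hr (h.happy (hp l hlm) (hgap _ (by simpa using hc)) (Nat.lt_succ_self j) hlr)
      · rw [Finset.card_image_of_injOn (hpinj.mono fun x hx => (Finset.mem_filter.1 hx).1)]
        exact Finset.card_filter_add_card_filter_not _
    · rintro c ⟨L, R, hLR, rfl⟩
      -- Weak duality: a cover contains an end of each matched edge, and these ends are distinct.
      have hsub : m ⊆ L ∪ (m.filter fun l => p l ∈ R) := by
        intro l hl
        have hact : act l := (Finset.mem_filter.1 hl).2.1
        rcases hLR l (p l) hact (h.sub (hp l hl)) with h1 | h1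
        · exact Finset.mem_union_left _ h1
        · exact Finset.mem_union_right _ (Finset.mem_filter.2 ⟨hl, h1⟩)
      refine (Finset.card_le_card hsub).trans ((Finset.card_union_le _ _).trans ?_)
      refine Nat.add_le_add_left (Finset.card_le_card_of_injOn p (fun a ha => ?_) ?_) _
      · exact (Finset.mem_filter.1 ha).2
      · intro a ha b hb hab
        have ha := (Finset.mem_filter.1 ha).1
        have hb := (Finset.mem_filter.1 hb).1
        exact h.right (hp a ha) (hab ▸ hp b hb)
  exact least.csInf_eq


/-! ### The auction as a program -/

/-- The programs that decide the problems have ten variables. The last one is never changed. -/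
abbrev Prog : Type := TabProg (Fin 10) Tab

open TabProg

/-- The number of prices that have been raised. -/
def priceSum (N : ℕ) (s : Store Tab) : ℕ :=
  ((Finset.range N ×ˢ Finset.range N).filter fun x => s.tab .price x.1 x.2 = true).card

theorem priceSum_le (N : ℕ) (s : Store Tab) : priceSum N s ≤ N * N := by
  refine (Finset.card_filter_le _ _).trans ?_
  simp

theorem priceSum_lt_bid {N : ℕ} {s : Store Tab} {l r k : ℕ} (hr : r < N) (hk : k < N)
    (h : s.tab .price r k = false) : priceSum N s < priceSum N (s.bid l r k) := by
  refine Finset.card_lt_card ⟨fun x hx => ?_, fun hc => ?_⟩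
  · simp only [Finset.mem_filter] at hx ⊢
    exact ⟨hx.1, by simp [Store.bid, hx.2]⟩
  · have := hc (x := (r, k)) (by simp [hr, hk, Store.bid])
    simp [h] at this

/-- The relation between the states of an auction in the course of time. -/
structure Later (N : ℕ) (G : ℕ → ℕ → Bool) (s t : Store Tab) : Prop where
  eq_or_lt : t = s ∨ priceSum N s < priceSum N t
  givenUp : ∀ l, GivenUp N G s l → GivenUp N G t l

theorem Later.refl {N : ℕ} {G : ℕ → ℕ → Bool} (s : Store Tab) : Later N G s s :=
  ⟨.inl rfl, fun _ h => h⟩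

theorem Later.trans {N : ℕ} {G : ℕ → ℕ → Bool} {s t u : Store Tab} (h : Later N G s t)
    (h' : Later N G t u) : Later N G s u := by
  refine ⟨?_, fun l hl => h'.givenUp l (h.givenUp l hl)⟩
  rcases h.eq_or_lt with rfl | h1
  · exact h'.eq_or_lt
  · rcases h'.eq_or_lt with rfl | h2
    · exact .inr h1
    · exact .inr (h1.trans h2)

/-- Only the bidder ceases to be free, and it has not given up, since its neighbour `r` is still
below the limit. Prices do not fall, so giving up is final. -/
theorem Later.bid {N : ℕ} {G : ℕ → ℕ → Bool} {s : Store Tab} {l r k : ℕ} (hr : r < N) (hk : k < N)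
    (hG : G l r = true) (h : s.tab .price r k = false) : Later N G s (s.bid l r k) := by
  refine ⟨.inr (priceSum_lt_bid hr hk h), fun l' hl' => ⟨?_, ?_⟩⟩
  · have : l' ≠ l := by
      rintro rfl
      have := hl'.2 r hG k hk
      simp [h] at this
    simp [Store.bid, this, hl'.1]
  · intro r' hr' k' hk'
    simp [Store.bid, hl'.2 r' hr' k' hk']

/-- The left vertex `x₀` gets the right vertex `x₁` and raises its price above `x₂`. -/
def bidProg : Prog :=
  .seq (.loop 3 (.ifTab .mat 3 1 (.seq (.set .mat 3 1 false) (.set .free 3 3 true)) .skip))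
    (.seq (.set .mat 0 1 true) (.seq (.set .free 0 0 false) (.set .price 1 2 true)))

/-- The left vertex `x₀` looks for the right vertex of least price, and bids for it. -/
def passProg : Prog :=
  .loop 2 (.loop 1 (.ifTab .free 0 0
    (.ifTab .adj 0 1 (.ifTab .price 1 2 .skip bidProg) .skip) .skip))

/-- Each left vertex may bid. -/
def roundProg : Prog := .loop 0 passProg

/-- Repeats a program often enough for an auction to end. -/
def often (p : Prog) : Prog := .loop 4 (.loop 5 (.loop 6 p))

/-- The loop visits only rows below `N`, while `Store.bid` changes the owner of `r` wherever it is;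
the hypothesis `hs` makes both agree. -/
theorem run_bidProg {N : ℕ} {s : Store Tab} {ρ : Fin 10 → ℕ}
    (hs : ∀ a b, s.tab .mat a b = true → a < N) :
    bidProg.run N ρ s = s.bid (ρ 0) (ρ 1) (ρ 2) := by
  set l := ρ 0
  set r := ρ 1
  set k := ρ 2
  -- The state when `r` has been taken away from its owners among the first `i` left vertices.
  let E : ℕ → Store Tab := fun i => ⟨fun t a b => match t with
    | .mat => if b = r ∧ a < i then false else s.tab .mat a b
    | .free => if a = b ∧ a < i then s.tab .mat a r || s.tab .free a b else s.tab .free a b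
    | t => s.tab t a b, s.inp⟩
  have h1 : upTo (fun i s => TabProg.run N (.ifTab .mat 3 1 (.seq (.set .mat 3 1 false)
      (.set .free 3 3 true)) .skip) (Function.update ρ 3 i) s) N s = E N := by
    refine upTo_induction (fun i t => t = E i) ?_ fun i hi t ht => ?_
    · ext t a b
      · cases t <;> simp [E]
      · rfl
    · subst ht
      have e : (E i).tab .mat i r = s.tab .mat i r := by simp [E]
      simp only [run, Function.update_self]
      rw [Function.update_of_ne (by decide)]
      rw [e]
      ext t a b
      · cases hm : s.tab .mat i r
        · simp only [Bool.false_eq_true, if_false]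
          cases t <;> simp only [E]
          · by_cases hb : b = r
            · subst hb
              rcases lt_trichotomy a i with h | rfl | h
              · simp [h, h.trans (Nat.lt_succ_self i)]
              · simp [hm]
              · simp [h.not_gt, show ¬ a < i + 1 by omega]
            · simp [hb]
          · by_cases hb : a = b
            · subst hb
              rcases lt_trichotomy a i with h | rfl | h
              · simp [h, h.trans (Nat.lt_succ_self i)]
              · simp [hm]
              · simp [h.not_gt, show ¬ a < i + 1 by omega]
            · simp [hb]
        · simp only [if_true, Store.set]
          cases t <;> simp only [E, reduceCtorEq, false_and, if_false, true_and]
          · by_cases hb : b = r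
            · subst hb
              rcases lt_trichotomy a i with h | rfl | h
              · simp [h, h.trans (Nat.lt_succ_self i)]
              · simp [r]
              · simp [h.not_gt, show ¬ a < i + 1 by omega, h.ne']
            · simp [hb, r]
          · by_cases hb : a = b
            · subst hb
              rcases lt_trichotomy a i with h | rfl | h
              · simp [h, h.trans (Nat.lt_succ_self i), h.ne]
              · simp [hm]
              · simp [h.not_gt, show ¬ a < i + 1 by omega, h.ne']
            · simp [hb]
              rintro rfl rfl
              exact absurd rfl hb
      · split <;> rfl
  have h2 : bidProg.run N ρ s =
      (((E N).set .mat l r true).set .free l l false).set .price r k true := by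
    rw [← h1]
    rfl
  rw [h2]
  ext t a b
  · cases t <;> simp only [E, Store.set, Store.bid, reduceCtorEq, false_and, if_false, true_and]
    · by_cases hb : b = r
      · subst hb
        by_cases ha : a = l
        · simp [ha]
        · simp only [ha, false_and, if_false, true_and, if_true, decide_false]
          by_cases haN : a < N
          · simp [haN]
          · have : s.tab .mat a r = false := by
              by_contra hc
              exact haN (hs a r (by simpa using hc))
            simp [this]
      · simp [hb]
    · by_cases hb : a = b
      · subst hb
        by_cases ha : a = l
        · simp [ha]
        · by_cases haN : a < N
          · simp [haN, ha]
          · have : s.tab .mat a r = false := by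
              by_contra hc
              exact haN (hs a r (by simpa using hc))
            simp [ha, haN, this]
      · have : ¬ (a = l ∧ b = l) := by rintro ⟨rfl, rfl⟩; exact hb rfl
        simp [hb, this]
  · rfl

section

variable {n N : ℕ} {G : ℕ → ℕ → Bool} {act : ℕ → Prop} {s : Store Tab} {ρ : Fin 10 → ℕ}

/-- The outer loop runs through the prices and the inner one through the right vertices, so the
first neighbour found is a cheapest one. After the bid `l` is not free, and the remaining rounds are
idle. -/
theorem run_passProg (hN : n ≤ N) (hG : ∀ l r, G l r = true → l < n ∧ r < n)
    (h : Valid N G act s) (hl : ρ 0 < N) :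
    Valid N G act (passProg.run N ρ s) ∧ Later N G s (passProg.run N ρ s) ∧
      ((passProg.run N ρ s).tab .free (ρ 0) (ρ 0) = true →
        GivenUp N G (passProg.run N ρ s) (ρ 0)) ∧
      ((s.tab .free (ρ 0) (ρ 0) = true → GivenUp N G s (ρ 0)) → passProg.run N ρ s = s) := by
  set l := ρ 0 with hl0
  -- While `l` is free, its neighbours cost at least `k`, and those before `r` cost more than `k`.
  let P : ℕ → ℕ → Store Tab → Prop := fun k r t => Valid N G act t ∧ Later N G s t ∧
    (t.tab .free l l = true → ∀ r', G l r' = true →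
      (∀ k' < k, t.tab .price r' k' = true) ∧ (r' < r → t.tab .price r' k = true)) ∧
    ((s.tab .free l l = true → GivenUp N G s l) → t = s)
  have h1 : P N 0 (passProg.run N ρ s) := by
    refine upTo_induction (fun k t => P k 0 t) ⟨h, .refl s, by simp, fun _ => rfl⟩ ?_
    intro k hk t ht
    have h2 : P k N (TabProg.run N (.loop 1 (.ifTab .free 0 0
        (.ifTab .adj 0 1 (.ifTab .price 1 2 .skip bidProg) .skip) .skip))
        (Function.update ρ 2 k) t) := by
      refine upTo_induction (fun r t => P k r t) ht ?_
      rintro r hr t ⟨hv, hlater, hfree, hsame⟩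
      set ρ' := Function.update (Function.update ρ 2 k) 1 r with hρ'
      have e0 : ρ' 0 = l := by simp [hρ', hl0]
      have e1 : ρ' 1 = r := by simp [hρ']
      have e2 : ρ' 2 = k := by simp [hρ']
      simp only [run, e0, e1, e2, hv.adj_eq]
      by_cases c1 : t.tab .free l l = true
      · rw [if_pos c1]
        have hfree' := hfree c1
        by_cases c2 : G l r = true
        · rw [if_pos c2]
          by_cases c3 : t.tab .price r k = true
          · rw [if_pos c3]
            refine ⟨hv, hlater, fun hf r' hr' => ⟨(hfree' r' hr').1, fun hlt => ?_⟩, hsame⟩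
            rcases (Nat.lt_succ_iff.1 hlt).lt_or_eq with h | rfl
            · exact (hfree' r' hr').2 h
            · exact c3
          · rw [if_neg c3]
            have c3 : t.tab .price r k = false := by simpa using c3
            rw [run_bidProg (fun a b hab => by
              have := (hG _ _ (hv.sub hab)).1; omega), e0, e1, e2]
            refine ⟨hv.bid hl c1 c2 (fun r' hr' => (hfree' r' hr').1) c3,
              hlater.trans (.bid hr hk c2 c3), ?_, fun hg => ?_⟩
            · intro hc
              simp [Store.bid] at hc
            · have := hsame hg
              subst this
              have := (hg c1).2 r c2 k hk
              simp [c3] at this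
        · rw [if_neg c2]
          refine ⟨hv, hlater, fun hf r' hr' => ⟨(hfree' r' hr').1, fun hlt => ?_⟩, hsame⟩
          rcases (Nat.lt_succ_iff.1 hlt).lt_or_eq with h | rfl
          · exact (hfree' r' hr').2 h
          · exact absurd hr' c2
      · rw [if_neg c1]
        exact ⟨hv, hlater, fun hc => absurd hc c1, hsame⟩
    obtain ⟨hv, hlater, hfree, hsame⟩ := h2
    refine ⟨hv, hlater, fun hf r' hr' => ⟨fun k' hk' => ?_, by simp⟩, hsame⟩
    rcases (Nat.lt_succ_iff.1 hk').lt_or_eq with h | rfl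
    · exact (hfree hf r' hr').1 k' h
    · exact (hfree hf r' hr').2 ((hG _ _ hr').2.trans_le hN)
  obtain ⟨hv, hlater, hfree, hsame⟩ := h1
  exact ⟨hv, hlater, fun hf => ⟨hf, fun r hr k hk => (hfree hf r hr).1 k hk⟩, hsame⟩

/-- The auction has ended. -/
def Ended (N : ℕ) (G : ℕ → ℕ → Bool) (s : Store Tab) : Prop :=
  ∀ l < N, s.tab .free l l = true → GivenUp N G s l

/-- Every change increases the number of raised prices, so a round that ends in its initial state
has changed nothing in between: no free vertex found a neighbour below the limit. -/
theorem run_roundProg (hN : n ≤ N) (hG : ∀ l r, G l r = true → l < n ∧ r < n)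
    (h : Valid N G act s) :
    Valid N G act (roundProg.run N ρ s) ∧ Later N G s (roundProg.run N ρ s) ∧
      (roundProg.run N ρ s = s → Ended N G s) ∧ (Ended N G s → roundProg.run N ρ s = s) := by
  refine upTo_induction (fun i t => Valid N G act t ∧ Later N G s t ∧
    (t = s → ∀ l < i, s.tab .free l l = true → GivenUp N G s l) ∧ (Ended N G s → t = s))
    ⟨h, .refl s, by simp, fun _ => rfl⟩ ?_
  rintro i hi t ⟨hv, hlater, hended, hsame⟩
  obtain ⟨h1, h2, h3, h4⟩ := run_passProg (ρ := Function.update ρ 0 i) hN hG hv (by simpa using hi)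
  simp only [Function.update_self] at h3 h4
  refine ⟨h1, hlater.trans h2, fun e l hl hf => ?_, fun he => ?_⟩
  · have ht : t = s := by
      rcases hlater.eq_or_lt with h5 | h5
      · exact h5
      · rcases h2.eq_or_lt with h6 | h6
        · rw [← h6, e]
        · rw [e] at h6
          omega
    rw [e] at h3
    rcases (Nat.lt_succ_iff.1 hl).lt_or_eq with h5 | rfl
    · exact hended ht l h5 hf
    · exact h3 hf
  · have ht := hsame he
    subst ht
    exact h4 (he i hi)

/-- What holds after every run of a program, and is stable, or is otherwise some progress, holds
after sufficiently many runs. -/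
theorem run_often (p : Prog) (I D : Store Tab → Prop) (μ : Store Tab → ℕ) (hN : 2 ≤ N)
    (h : ∀ ρ s, I s → I (p.run N ρ s) ∧ (D s → D (p.run N ρ s)) ∧
      (D (p.run N ρ s) ∨ μ s < μ (p.run N ρ s)))
    (hμ : ∀ s, μ s ≤ N * N) (hs : I s) : I ((often p).run N ρ s) ∧ D ((often p).run N ρ s) := by
  have loop : ∀ (q : Prog) (x : Fin 10) (c : ℕ),
      (∀ ρ s i, I s ∧ (D s ∨ i ≤ μ s) → I (q.run N ρ s) ∧
        (D (q.run N ρ s) ∨ i + c ≤ μ (q.run N ρ s))) →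
      ∀ ρ s i, I s ∧ (D s ∨ i ≤ μ s) → I ((TabProg.loop x q).run N ρ s) ∧
        (D ((TabProg.loop x q).run N ρ s) ∨ i + c * N ≤ μ ((TabProg.loop x q).run N ρ s)) := by
    intro q x c hq ρ s i hi
    refine upTo_induction (fun j t => I t ∧ (D t ∨ i + c * j ≤ μ t)) (by simpa using hi) ?_
    intro j _ t ht
    have := hq (Function.update ρ x j) t _ ht
    rwa [add_assoc, ← Nat.mul_succ] at this
  -- Unless `D` is reached, each level of nesting multiplies the guaranteed progress by `N`. A
  -- progress of `N * N * N` contradicts the bound `N * N`, because `2 ≤ N`.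
  have := loop _ 4 _ (loop _ 5 _ (loop p 6 1 fun ρ s i hi => ?_)) ρ s 0 ⟨hs, .inr (Nat.zero_le _)⟩
  · refine ⟨this.1, this.2.resolve_right fun hc => ?_⟩
    have h1 := hc.trans (hμ _)
    have h2 : N * N * 2 ≤ N * N * N := Nat.mul_le_mul_left _ hN
    have h3 : 0 < N * N := by positivity
    rw [zero_add, one_mul] at h1
    omega
  · obtain ⟨h1, h2, h3⟩ := h ρ s hi.1
    refine ⟨h1, ?_⟩
    rcases hi.2 with h4 | h4
    · exact .inl (h2 h4)
    · rcases h3 with h3 | h3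
      · exact .inl h3
      · exact .inr (by omega)

theorem run_auction (hN2 : 2 ≤ N) (hN : n ≤ N) (hG : ∀ l r, G l r = true → l < n ∧ r < n)
    (h : Valid N G act s) :
    Valid N G act ((often roundProg).run N ρ s) ∧ Later N G s ((often roundProg).run N ρ s) ∧
      Ended N G ((often roundProg).run N ρ s) := by
  have := run_often (ρ := ρ) roundProg (fun t => Valid N G act t ∧ Later N G s t) (Ended N G)
    (priceSum N) hN2 ?_ (priceSum_le N) ⟨h, .refl s⟩
  · exact ⟨this.1.1, this.1.2, this.2⟩
  · rintro ρ t ⟨hv, hl⟩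
    obtain ⟨h1, h2, h3, h4⟩ := run_roundProg (ρ := ρ) hN hG hv
    refine ⟨⟨h1, hl.trans h2⟩, fun he => by rwa [h4 he], ?_⟩
    rcases h2.eq_or_lt with h5 | h5
    · exact .inl (by rw [h5]; exact h3 h5)
    · exact .inr h5

end


/-! ### The effect of a single left vertex on the matching -/

/-- Prepares an auction in which all left vertices but `x₇` take part. -/
def resetProg : Prog :=
  .seq (.loop 0 (.loop 1 (.seq (.set .mat 0 1 false) (.set .price 0 1 false))))
    (.seq (.loop 0 (.set .free 0 0 true)) (.set .free 7 7 false))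

/-- Records the left vertices that have given up, and lets the vertex `x₇` take part. -/
def admitProg : Prog :=
  .seq (.loop 0 (.ifTab .free 0 0 (.set .prev 0 0 true) (.set .prev 0 0 false)))
    (.set .free 7 7 true)

/-- Marks the vertex `x₇` if some left vertex has given up since the last record. -/
def markProg : Prog :=
  .loop 0 (.ifTab .free 0 0 (.ifTab .prev 0 0 .skip (.set .crit 7 7 true)) .skip)

/-- Decides whether a matching grows when the left vertex `x₇` takes part. -/
def critBody : Prog :=
  .seq resetProg (.seq (often roundProg) (.seq admitProg (.seq (often roundProg) markProg)))

/-- Marks the left vertices that are missed by some largest matching. -/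
def critProg : Prog := .loop 7 critBody

section

variable {n N : ℕ} {G : ℕ → ℕ → Bool} {s : Store Tab} {ρ : Fin 10 → ℕ}

theorem valid_run_resetProg (hρ : ∀ x, ρ x < N) (hs : s.Small N) (hG : s.tab .adj = G) :
    Valid N G (fun l => l ≠ ρ 7) (resetProg.run N ρ s) := by
  set t := resetProg.run N ρ s with ht
  set p1 : Prog := .loop 0 (.loop 1 (.seq (.set .mat 0 1 false) (.set .price 0 1 false)))
  set p2 : Prog := .loop 0 (.set .free 0 0 true)
  set p3 : Prog := .set .free 7 7 false
  have hts : t.Small N := run_small N _ ρ hρ s hs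
  have hadj : t.tab .adj = G := (run_tab_of_notMem N _ (by decide) ρ s).trans hG
  have h1 : ∀ a < N, ∀ b < N, (p1.run N ρ s).tab .mat a b = false ∧
      (p1.run N ρ s).tab .price a b = false := by
    refine upTo_induction (fun i (t : Store Tab) => ∀ a < i, ∀ b < N, t.tab .mat a b = false ∧
      t.tab .price a b = false) (by simp) fun i hi t ht => ?_
    have : (∀ a < i, ∀ b < N, (TabProg.run N (.loop 1 (.seq (.set .mat 0 1 false)
          (.set .price 0 1 false))) (Function.update ρ 0 i) t).tab .mat a b = false ∧
          (TabProg.run N (.loop 1 (.seq (.set .mat 0 1 false)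
          (.set .price 0 1 false))) (Function.update ρ 0 i) t).tab .price a b = false) ∧
        ∀ b < N, (TabProg.run N (.loop 1 (.seq (.set .mat 0 1 false)
          (.set .price 0 1 false))) (Function.update ρ 0 i) t).tab .mat i b = false ∧
          (TabProg.run N (.loop 1 (.seq (.set .mat 0 1 false)
          (.set .price 0 1 false))) (Function.update ρ 0 i) t).tab .price i b = false := by
      refine upTo_induction (fun j (t : Store Tab) => (∀ a < i, ∀ b < N, t.tab .mat a b = false ∧
        t.tab .price a b = false) ∧ ∀ b < j, t.tab .mat i b = false ∧ t.tab .price i b = false)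
        ⟨ht, by simp⟩ fun j hj t ht => ⟨fun a ha b hb => ?_, fun b hb => ?_⟩
      · simp [run, Store.set, ht.1 a ha b hb]
      · rcases (Nat.lt_succ_iff.1 hb).lt_or_eq with h | rfl
        · simp [run, Store.set, ht.2 b h]
        · simp [run, Store.set]
    intro a ha b hb
    rcases (Nat.lt_succ_iff.1 ha).lt_or_eq with h | rfl
    · exact this.1 a h b hb
    · exact this.2 b hb
  have h2 : ∀ a < N, (p2.run N ρ (p1.run N ρ s)).tab .free a a = true := by
    refine upTo_induction (fun i (t : Store Tab) => ∀ a < i, t.tab .free a a = true) (by simp) ?_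
    intro i hi t ht a ha
    rcases (Nat.lt_succ_iff.1 ha).lt_or_eq with h | rfl
    · simp [run, Store.set, ht a h]
    · simp [run, Store.set]
  have e : t = p3.run N ρ (p2.run N ρ (p1.run N ρ s)) := rfl
  have hfree : ∀ a < N, t.tab .free a a = true ↔ a ≠ ρ 7 := by
    intro a ha
    rw [e]
    simp [p3, run, Store.set, h2 a ha]
  have hmat : ∀ a b, t.tab .mat a b = false := by
    intro a b
    by_contra hc
    have := hts .mat a b (by simpa using hc)
    apply hc
    rw [e, run_tab_of_notMem N p3 (by decide), run_tab_of_notMem N p2 (by decide)]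
    exact (h1 a this.1 b this.2).1
  have hprice : ∀ a b, t.tab .price a b = false := by
    intro a b
    by_contra hc
    have := hts .price a b (by simpa using hc)
    apply hc
    rw [e, run_tab_of_notMem N p3 (by decide), run_tab_of_notMem N p2 (by decide)]
    exact (h1 a this.1 b this.2).2
  refine ⟨hadj, ?_, ?_, ?_, ?_, ?_, ?_, ?_, ?_⟩
  · simp [hmat]
  · simp [hmat]
  · simp [hmat]
  · intro l hl
    rw [← hfree l hl]
    simp [hmat]
  · intro l hl
    exact (hfree l hl).1
  · simp [hprice]
  · simp [hprice]
  · simp [hprice]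

/-- A running auction admits a new bidder: the invariant asks of a free vertex only that it may take
part. The record is made before the admission, so it does not count `x₇` as having given up. -/
theorem run_admitProg (h : Valid N G (fun l => l ≠ ρ 7) s) :
    Valid N G (fun _ => True) (admitProg.run N ρ s) ∧
      (∀ l, GivenUp N G s l → GivenUp N G (admitProg.run N ρ s) l) ∧
      ∀ l < N, (admitProg.run N ρ s).tab .prev l l = s.tab .free l l := by
  set t := admitProg.run N ρ s with ht
  set p : Prog := .loop 0 (.ifTab .free 0 0 (.set .prev 0 0 true) (.set .prev 0 0 false))
  have hp : ∀ a, a ≠ .prev → (p.run N ρ s).tab a = s.tab a := fun a ha =>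
    run_tab_of_notMem N p (by simpa [p, writes] using ha) ρ s
  have e : t = (p.run N ρ s).set .free (ρ 7) (ρ 7) true := rfl
  have hother : ∀ a, a ≠ .prev → a ≠ .free → t.tab a = s.tab a := by
    intro a ha ha'
    rw [e, ← hp a ha]
    funext i j
    simp [Store.set, ha']
  have hfree : ∀ i, t.tab .free i i = true ↔ i = ρ 7 ∨ s.tab .free i i = true := by
    intro i
    rw [e, ← hp .free (by simp)]
    by_cases hi : i = ρ 7 <;> simp [Store.set, hi]
  have hprev : ∀ l < N, (p.run N ρ s).tab .prev l l = s.tab .free l l := by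
    have : (p.run N ρ s).tab .free = s.tab .free ∧
        ∀ l < N, (p.run N ρ s).tab .prev l l = s.tab .free l l := by
      refine upTo_induction (fun i (t : Store Tab) => t.tab .free = s.tab .free ∧
        ∀ l < i, t.tab .prev l l = s.tab .free l l) (by simp) ?_
      rintro i hi t ⟨h1, h2⟩
      cases hc : s.tab .free i i <;> simp only [run, Function.update_self, h1, hc, if_true,
        Bool.false_eq_true, if_false]
      all_goals
        refine ⟨?_, fun l hl => ?_⟩
        · rw [← h1]
          funext i j
          simp [Store.set]
        · rcases (Nat.lt_succ_iff.1 hl).lt_or_eq with h | rfl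
          · simp [Store.set, h.ne, h2 l h]
          · simp [Store.set, hc]
    exact this.2
  have hm := hother .mat (by simp) (by simp)
  have hpr := hother .price (by simp) (by simp)
  refine ⟨⟨?_, ?_, ?_, ?_, ?_, ?_, ?_, ?_, ?_⟩, ?_, ?_⟩
  · rw [hother .adj (by simp) (by simp), h.adj_eq]
  · rw [hm]; exact h.sub
  · rw [hm]; exact h.left
  · rw [hm]; exact h.right
  · intro l hl
    rw [hm, h.matched_iff l hl, ← Bool.not_eq_true, ← Bool.not_eq_true, hfree]
    tauto
  · exact fun _ _ _ => trivial
  · rw [hpr]; exact h.down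
  · rw [hm, hpr]; exact h.sold
  · rw [hm, hpr]; exact h.happy
  · intro l hl
    exact ⟨(hfree l).2 (.inr hl.1), by rw [hpr]; exact hl.2⟩
  · intro l hl
    rw [e, ← hprev l hl]
    simp [Store.set]

theorem run_markProg : (∀ l, l ≠ ρ 7 → (markProg.run N ρ s).tab .crit l l = s.tab .crit l l) ∧
    ((markProg.run N ρ s).tab .crit (ρ 7) (ρ 7) = true ↔ s.tab .crit (ρ 7) (ρ 7) = true ∨
      ∃ l < N, s.tab .free l l = true ∧ s.tab .prev l l = false) := by
  have := upTo_induction (f := fun i t => TabProg.run N (.ifTab .free 0 0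
    (.ifTab .prev 0 0 .skip (.set .crit 7 7 true)) .skip) (Function.update ρ 0 i) t) (s := s)
    (n := N) (fun i t => (∀ a, a ≠ .crit → t.tab a = s.tab a) ∧
      (∀ l, l ≠ ρ 7 → t.tab .crit l l = s.tab .crit l l) ∧
      (t.tab .crit (ρ 7) (ρ 7) = true ↔ s.tab .crit (ρ 7) (ρ 7) = true ∨
      ∃ l < i, s.tab .free l l = true ∧ s.tab .prev l l = false)) (by simp) ?_
  · exact this.2
  · rintro i hi t ⟨h1, h2, h3⟩
    have e : (∃ l < i + 1, s.tab .free l l = true ∧ s.tab .prev l l = false) ↔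
        (∃ l < i, s.tab .free l l = true ∧ s.tab .prev l l = false) ∨
          (s.tab .free i i = true ∧ s.tab .prev i i = false) := by
      simp only [Nat.lt_succ_iff_lt_or_eq, or_and_right, exists_or, exists_eq_left]
    have h7 : Function.update ρ 0 i 7 = ρ 7 := Function.update_of_ne (by decide) _ _
    rw [e, ← or_assoc, ← h3]
    simp only [run, Function.update_self, h7, h1 .free (by simp), h1 .prev (by simp)]
    by_cases c1 : s.tab .free i i = true
    · by_cases c2 : s.tab .prev i i = true
      · simp only [c1, c2, if_true]
        exact ⟨h1, h2, by simp⟩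
      · simp only [c1, c2, if_true]
        refine ⟨fun a ha => ?_, fun l hl => ?_, ?_⟩
        · rw [← h1 a ha]
          funext i j
          simp [Store.set, ha]
        · rw [← h2 l hl]
          simp [Store.set, hl]
        · simp [Store.set]
    · simp only [c1]
      exact ⟨h1, h2, by simp⟩

/-- Let `B` be the left vertices that are not free after the first auction, among them `v`, which
did not take part, and `A` those not free after the second. The matchings have sizes `B.card - 1`
and `A.card`, and `A ⊆ B` because giving up is final. So the matching does not grow exactly if `A ≠
B`, that is, if some vertex has newly given up. -/
theorem run_critBody (hn : n + 1 < N) (hG : ∀ l r, G l r = true → l < n ∧ r < n)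
    (hρ : ∀ x, ρ x < N) (hs : s.Small N) (hadj : s.tab .adj = G) :
    (∀ l, l ≠ ρ 7 → (critBody.run N ρ s).tab .crit l l = s.tab .crit l l) ∧
    ((critBody.run N ρ s).tab .crit (ρ 7) (ρ 7) = true ↔ s.tab .crit (ρ 7) (ρ 7) = true ∨
      coverNum G (fun _ => True) ≤ coverNum G (fun l => l ≠ ρ 7)) := by
  set v := ρ 7 with hv
  have hvN : v < N := hρ 7
  set s1 := resetProg.run N ρ s with hs1
  set s2 := (often roundProg).run N ρ s1 with hs2
  set s3 := admitProg.run N ρ s2 with hs3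
  set s4 := (often roundProg).run N ρ s3 with hs4
  have e : critBody.run N ρ s = markProg.run N ρ s4 := rfl
  have v1 := valid_run_resetProg hρ hs hadj
  obtain ⟨v2, -, end2⟩ := run_auction (ρ := ρ) (by omega) (by omega) hG v1
  obtain ⟨v3, keep3, prev3⟩ := run_admitProg v2
  obtain ⟨v4, later4, end4⟩ := run_auction (ρ := ρ) (by omega) (by omega) hG v3
  have hcrit : s4.tab .crit = s.tab .crit := by
    rw [hs4, run_tab_of_notMem N _ (by decide), hs3, run_tab_of_notMem N _ (by decide), hs2,
      run_tab_of_notMem N _ (by decide), hs1, run_tab_of_notMem N _ (by decide)]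
  have hprev : ∀ l < N, s4.tab .prev l l = s2.tab .free l l := by
    intro l hl
    rw [hs4, run_tab_of_notMem N _ (by decide)]
    exact prev3 l hl
  obtain ⟨m1, m2⟩ := run_markProg (N := N) (s := s4) (ρ := ρ)
  rw [e]
  refine ⟨fun l hl => by rw [m1 l hl, hcrit], ?_⟩
  rw [m2, hcrit, v2.coverNum_eq hn hG end2, v4.coverNum_eq hn hG end4]
  refine or_congr Iff.rfl ?_
  have mono : ∀ l < N, s2.tab .free l l = true → s4.tab .free l l = true := fun l hl h =>
    (later4.givenUp l (keep3 l (end2 l hl h))).1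
  have hvfree : s2.tab .free v v = false := by
    by_contra hc
    exact v2.act_of_free v hvN (by simpa using hc) rfl
  set B := (Finset.range N).filter fun l => s2.tab .free l l = false with hB
  set A := (Finset.range N).filter fun l => True ∧ s4.tab .free l l = false with hA
  have hBe : ((Finset.range N).filter fun l => l ≠ v ∧ s2.tab .free l l = false) = B.erase v := by
    ext l
    simp only [hB, Finset.mem_filter, Finset.mem_erase, Finset.mem_range]
    tauto
  have hvB : v ∈ B := by simp [hB, hvN, hvfree]
  have hAB : A ⊆ B := by
    intro l hl
    simp only [hA, true_and, Finset.mem_filter, Finset.mem_range] at hl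
    simp only [hB, Finset.mem_filter, Finset.mem_range]
    refine ⟨hl.1, ?_⟩
    by_contra hc
    have := mono l hl.1 (by simpa using hc)
    simp [hl.2] at this
  rw [hBe, Finset.card_erase_of_mem hvB]
  have hpos : 0 < B.card := Finset.card_pos.2 ⟨v, hvB⟩
  constructor
  · rintro ⟨l, hl, h1, h2⟩
    have hlB : l ∈ B := by simp [hB, hl, ← hprev l hl, h2]
    have hlA : l ∉ A := by simp [hA, h1]
    have := Finset.card_lt_card ⟨hAB, fun hc => hlA (hc hlB)⟩
    omega
  · intro hle
    by_contra hc
    push Not at hc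
    have : B ⊆ A := by
      intro l hl
      simp only [hB, Finset.mem_filter, Finset.mem_range] at hl
      simp only [hA, true_and, Finset.mem_filter, Finset.mem_range]
      refine ⟨hl.1, ?_⟩
      by_contra hf
      exact hc l hl.1 (by simpa using hf) ((hprev l hl.1).trans hl.2)
    have := Finset.card_le_card this
    omega

theorem run_critProg (hn : n + 1 < N) (hG : ∀ l r, G l r = true → l < n ∧ r < n)
    (hρ : ∀ x, ρ x < N) (hs : s.Small N) (hadj : s.tab .adj = G)
    (hcrit : ∀ v, s.tab .crit v v = false) (v : ℕ) (hv : v < N) :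
    (critProg.run N ρ s).tab .crit v v = true ↔
      coverNum G (fun _ => True) ≤ coverNum G (fun l => l ≠ v) := by
  have := upTo_induction (f := fun i t => critBody.run N (Function.update ρ 7 i) t) (s := s)
    (n := N) (fun i t => t.Small N ∧ t.tab .adj = G ∧ (∀ v ≥ i, t.tab .crit v v = false) ∧
      ∀ v < i, t.tab .crit v v = true ↔
        coverNum G (fun _ => True) ≤ coverNum G (fun l => l ≠ v))
    ⟨hs, hadj, fun v _ => hcrit v, by simp⟩ ?_
  · exact this.2.2.2 v hv
  · rintro i hi t ⟨h1, h2, h3, h4⟩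
    have hρ' : ∀ x, Function.update ρ 7 i x < N := by
      intro x
      by_cases hx : x = 7
      · subst hx; simpa using hi
      · simpa [hx] using hρ x
    obtain ⟨h5, h6⟩ := run_critBody hn hG hρ' h1 h2
    rw [Function.update_self] at h5 h6
    refine ⟨run_small N _ _ hρ' _ h1, (run_tab_of_notMem N _ (by decide) _ _).trans h2,
      fun w hw => ?_, fun w hw => ?_⟩
    · rw [h5 w (by omega)]
      exact h3 w (by omega)
    · rcases (Nat.lt_succ_iff.1 hw).lt_or_eq with h | rfl
      · rw [h5 w (by omega)]
        exact h4 w h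
      · rw [h6, h3 w le_rfl]
        simp

end


/-! ### Vertex covers, spared vertices and doubled bipartite graphs -/

/-- The adjacency matrix of a graph, continued by `false`. -/
noncomputable def adjTable {n : ℕ} (G : SimpleGraph (Fin n)) (i j : ℕ) : Bool :=
  open Classical in decide (∃ (hi : i < n) (hj : j < n), G.Adj ⟨i, hi⟩ ⟨j, hj⟩)

theorem adjTable_iff {n : ℕ} (G : SimpleGraph (Fin n)) (i j : ℕ) :
    adjTable G i j = true ↔ ∃ (hi : i < n) (hj : j < n), G.Adj ⟨i, hi⟩ ⟨j, hj⟩ := by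
  simp [adjTable]

theorem adjTable_val {n : ℕ} (G : SimpleGraph (Fin n)) (i j : Fin n) :
    adjTable G i j = true ↔ G.Adj i j := by
  simp [adjTable]

theorem exists_isBicover {n : ℕ} (G : SimpleGraph (Fin n)) (act : ℕ → Prop) :
    ∃ L R, IsBicover (adjTable G) act L R ∧ L.card + R.card = coverNum (adjTable G) act := by
  refine Nat.sInf_mem (s := {c | ∃ L R, IsBicover (adjTable G) act L R ∧ L.card + R.card = c})
    ⟨_, Finset.range n, ∅, fun l r _ h => ?_, rfl⟩
  obtain ⟨hl, -, -⟩ := (adjTable_iff G l r).1 h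
  exact .inl (Finset.mem_range.2 hl)

theorem coverNum_le {G : ℕ → ℕ → Bool} {act : ℕ → Prop} {L R : Finset ℕ}
    (h : IsBicover G act L R) : coverNum G act ≤ L.card + R.card :=
  Nat.sInf_le ⟨L, R, h, rfl⟩

/-- A vertex is spared if no least vertex cover contains it. -/
def Spared {n : ℕ} (G : SimpleGraph (Fin n)) (v : Fin n) : Prop :=
  ∀ C : Finset (Fin n), G.IsVertexCover (C : Set (Fin n)) → v ∈ C → G.vertexCoverNum < C.card

theorem exists_finset_vertexCoverNum {n : ℕ} (G : SimpleGraph (Fin n)) :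
    ∃ C : Finset (Fin n), G.IsVertexCover (C : Set (Fin n)) ∧ (C.card : ℕ∞) = G.vertexCoverNum := by
  classical
  obtain ⟨s, hs, hs'⟩ := G.vertexCoverNum_exists
  refine ⟨s.toFinset, by simpa using hs', ?_⟩
  rw [← hs, ← Set.encard_coe_eq_coe_finsetCard, Set.coe_toFinset]

theorem vertexCoverNum_le_card {n : ℕ} {G : SimpleGraph (Fin n)} {C : Finset (Fin n)}
    (h : G.IsVertexCover (C : Set (Fin n))) : G.vertexCoverNum ≤ C.card := by
  simpa using h.vertexCoverNum_le

/-- A cover of a bipartite graph with doubled vertices consists of two covers of the graph. -/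
theorem exists_split {n : ℕ} {G : SimpleGraph (Fin n)} (hG : G.IsBipartite) (v : Fin n)
    {L R : Finset ℕ} (h : IsBicover (adjTable G) (fun _ => True) L R) :
    ∃ C D : Finset (Fin n), (v.val ∈ L → v ∈ C) ∧ G.IsVertexCover (C : Set (Fin n)) ∧
      G.IsVertexCover (D : Set (Fin n)) ∧ C.card + D.card ≤ L.card + R.card := by
  classical
  obtain ⟨c⟩ := hG
  have hc : ∀ {x y}, G.Adj x y → (c x = c v ↔ c y ≠ c v) := by
    intro x y hxy
    have := c.valid hxy
    omega
  have hcov : ∀ {x y}, G.Adj x y → x.val ∈ L ∨ y.val ∈ R := fun {x y} hxy =>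
    h x y trivial ((adjTable_val G x y).2 hxy)
  -- The double falls into two copies of `G`: left copies of the colour class of `v` with right
  -- copies of the other class, and vice versa. `C` is the trace of the cover on the copy with left
  -- `v`, and `D` that on the other.
  let C := Finset.univ.filter fun x : Fin n => (c x = c v ∧ x.val ∈ L) ∨ (c x ≠ c v ∧ x.val ∈ R)
  let D := Finset.univ.filter fun x : Fin n => (c x ≠ c v ∧ x.val ∈ L) ∨ (c x = c v ∧ x.val ∈ R)
  have half : ∀ {x y}, G.Adj x y → c x = c v → x ∈ C ∨ y ∈ C := by
    intro x y hxy hx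
    rcases hcov hxy with h1 | h1
    · left; simp [C, hx, h1]
    · right; simp [C, (hc hxy).1 hx, h1]
  have half' : ∀ {x y}, G.Adj x y → c x ≠ c v → x ∈ D ∨ y ∈ D := by
    intro x y hxy hx
    have hy : c y = c v := by
      by_contra hy
      exact hx ((hc hxy).2 hy)
    rcases hcov hxy with h1 | h1
    · left; simp [D, hx, h1]
    · right; simp [D, hy, h1]
  refine ⟨C, D, fun hv => by simp [C, hv], fun x y hxy => ?_, fun x y hxy => ?_, ?_⟩
  · simp only [Finset.mem_coe]
    by_cases hx : c x = c v
    · exact half hxy hx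
    · exact (half hxy.symm (by by_contra hy; exact hx ((hc hxy).2 hy))).symm
  · simp only [Finset.mem_coe]
    by_cases hx : c x = c v
    · exact (half' hxy.symm ((hc hxy).1 hx)).symm
    · exact half' hxy hx
  · have hCD : ∀ x, (if x ∈ C then 1 else 0) + (if x ∈ D then 1 else 0) =
        (if x.val ∈ L then 1 else 0) + (if x.val ∈ R then 1 else 0) := by
      intro x
      by_cases hx : c x = c v
      · simp [C, D, hx]
      · simp [C, D, hx, add_comm]
    have sum : ∀ S : Finset (Fin n), S.card = ∑ x, if x ∈ S then 1 else 0 := fun S => by simp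
    have le : ∀ S : Finset ℕ, (∑ x : Fin n, if x.val ∈ S then 1 else 0) ≤ S.card := by
      intro S
      rw [Finset.sum_boole, Nat.cast_id]
      exact Finset.card_le_card_of_injOn Fin.val (fun x hx => by simpa using hx)
        (fun x _ y _ hxy => Fin.ext hxy)
    rw [sum C, sum D, ← Finset.sum_add_distrib, Finset.sum_congr rfl fun x _ => hCD x,
      Finset.sum_add_distrib]
    exact Nat.add_le_add (le _) (le _)

/-- Let `β` be the cover number of `G`; that of the double is `2β`. A least cover through `v`,
doubled and without the left copy of `v`, has size `2β - 1` and covers the edges at the other left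
vertices. Conversely, a cover of those edges becomes one of the double by adding left `v`, and
splits into `C` through `v` and `D`; if `v` is spared, then `C` has more than `β` elements, so the
given cover had at least `2β`. -/
theorem spared_iff {n : ℕ} {G : SimpleGraph (Fin n)} (hG : G.IsBipartite) (v : Fin n) :
    Spared G v ↔ coverNum (adjTable G) (fun _ => True) ≤
      coverNum (adjTable G) (fun l => l ≠ v.val) := by
  classical
  obtain ⟨K, hK, hKc⟩ := exists_finset_vertexCoverNum G
  have hmin : ∀ C : Finset (Fin n), G.IsVertexCover (C : Set (Fin n)) → K.card ≤ C.card := by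
    intro C hC
    have := vertexCoverNum_le_card hC
    rw [← hKc] at this
    exact_mod_cast this
  have hsp : Spared G v ↔
      ∀ C : Finset (Fin n), G.IsVertexCover (C : Set (Fin n)) → v ∈ C → K.card < C.card := by
    simp only [Spared, ← hKc, Nat.cast_lt]
  have double : ∀ C : Finset (Fin n), G.IsVertexCover (C : Set (Fin n)) →
      IsBicover (adjTable G) (fun _ => True) (C.map Fin.valEmbedding) (C.map Fin.valEmbedding) := by
    intro C hC l r _ hlr
    obtain ⟨hl, hr, hadj⟩ := (adjTable_iff G l r).1 hlr
    rcases hC hadj with h | h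
    · exact .inl (Finset.mem_map.2 ⟨_, h, rfl⟩)
    · exact .inr (Finset.mem_map.2 ⟨_, h, rfl⟩)
  rw [hsp]
  constructor
  · intro h
    obtain ⟨L, R, hLR, hcard⟩ := exists_isBicover G (fun l => l ≠ v.val)
    have hLR' : IsBicover (adjTable G) (fun _ => True) (insert v.val L) R := by
      intro l r _ hlr
      by_cases hl : l = v.val
      · exact .inl (Finset.mem_insert.2 (.inl hl))
      · exact (hLR l r hl hlr).imp_left Finset.mem_insert_of_mem
    obtain ⟨C, D, hvC, hC, hD, hCD⟩ := exists_split hG v hLR'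
    have h1 := coverNum_le (double K hK)
    simp only [Finset.card_map] at h1
    have h2 := h C hC (hvC (Finset.mem_insert_self _ _))
    have h3 := hmin D hD
    have h4 := Finset.card_insert_le v.val L
    omega
  · intro h C hC hvC
    by_contra hlt
    have hCK : C.card = K.card := le_antisymm (not_lt.1 hlt) (hmin C hC)
    have hb : IsBicover (adjTable G) (fun l => l ≠ v.val) ((C.map Fin.valEmbedding).erase v.val)
        (C.map Fin.valEmbedding) := by
      intro l r hl hlr
      rcases double C hC l r trivial hlr with h1 | h1
      · exact .inl (Finset.mem_erase.2 ⟨hl, h1⟩)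
      · exact .inr h1
    have h1 := coverNum_le hb
    have hvm : v.val ∈ C.map Fin.valEmbedding := Finset.mem_map.2 ⟨v, hvC, rfl⟩
    rw [Finset.card_erase_of_mem hvm, Finset.card_map] at h1
    have hpos : 0 < C.card := Finset.card_pos.2 ⟨v, hvC⟩
    obtain ⟨L, R, hLR, hcard⟩ := exists_isBicover G (fun _ => True)
    obtain ⟨C', D, -, hC', hD, hCD⟩ := exists_split hG v hLR
    have := hmin C' hC'
    have := hmin D hD
    omega

/-- The covers of the larger graph are the covers of `G` that meet `{u, v}`, so the number is
unchanged exactly if a least cover of `G` contains `u` or `v`. -/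
theorem vertexCoverNum_add_edge_eq_iff {n : ℕ} (G : SimpleGraph (Fin n)) {u v : Fin n}
    (huv : u ≠ v) :
    (G ⊔ SimpleGraph.edge u v).vertexCoverNum = G.vertexCoverNum ↔ ¬ (Spared G u ∧ Spared G v) := by
  have cov : ∀ C : Set (Fin n), (G ⊔ SimpleGraph.edge u v).IsVertexCover C ↔
      G.IsVertexCover C ∧ (u ∈ C ∨ v ∈ C) := by
    intro C
    constructor
    · intro h
      refine ⟨h.mono le_sup_left, h (v := u) (w := v) ?_⟩
      simp [SimpleGraph.edge_adj, huv]
    · rintro ⟨h, huv'⟩ x y hxy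
      rcases hxy with hxy | hxy
      · exact h hxy
      · rw [SimpleGraph.edge_adj] at hxy
        rcases hxy.1 with ⟨rfl, rfl⟩ | ⟨rfl, rfl⟩
        · exact huv'
        · exact huv'.symm
  constructor
  · rintro h ⟨hu, hv⟩
    obtain ⟨C, hC, hcard⟩ := exists_finset_vertexCoverNum (G ⊔ SimpleGraph.edge u v)
    rw [h] at hcard
    obtain ⟨hC, hmem⟩ := (cov _).1 hC
    rcases hmem with hmem | hmem
    · exact (hu C hC hmem).ne' hcard
    · exact (hv C hC hmem).ne' hcard
  · intro h
    refine le_antisymm ?_ (SimpleGraph.vertexCoverNum_mono le_sup_left)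
    rw [not_and_or] at h
    have : ∃ C : Finset (Fin n), G.IsVertexCover (C : Set (Fin n)) ∧ (u ∈ C ∨ v ∈ C) ∧
        (C.card : ℕ∞) ≤ G.vertexCoverNum := by
      simp only [Spared, not_forall, not_lt] at h
      rcases h with ⟨C, h1, h2, h3⟩ | ⟨C, h1, h2, h3⟩
      · exact ⟨C, h1, .inl h2, h3⟩
      · exact ⟨C, h1, .inr h2, h3⟩
    obtain ⟨C, h1, h2, h3⟩ := this
    exact (vertexCoverNum_le_card ((cov _).2 ⟨h1, h2⟩)).trans h3

theorem isUnfrozen_vertexCoverNum_iff {n : ℕ} (G : SimpleGraph (Fin n)) :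
    IsUnfrozen SimpleGraph.vertexCoverNum G ↔
      ∀ u v, u ≠ v → ¬ G.Adj u v → ¬ (Spared G u ∧ Spared G v) :=
  forall₄_congr fun _ _ huv _ => vertexCoverNum_add_edge_eq_iff G huv

theorem isFrozen_vertexCoverNum_iff {n : ℕ} (G : SimpleGraph (Fin n)) :
    IsFrozen SimpleGraph.vertexCoverNum G ↔
      ∀ u v, u ≠ v → ¬ G.Adj u v → Spared G u ∧ Spared G v :=
  forall₄_congr fun u v huv _ => by
    rw [Ne, vertexCoverNum_add_edge_eq_iff G huv, not_not]

/-- Gallai's identity: the complements of vertex covers are the independent sets. -/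
theorem vertexCoverNum_add_indepNum {n : ℕ} (G : SimpleGraph (Fin n)) :
    G.vertexCoverNum + (G.indepNum : ℕ∞) = n := by
  classical
  obtain ⟨C, hC, hcard⟩ := exists_finset_vertexCoverNum G
  obtain ⟨I, hI⟩ := G.exists_isNIndepSet_indepNum
  rw [SimpleGraph.isNIndepSet_iff] at hI
  have h1 : (Cᶜ).card ≤ G.indepNum := by
    refine SimpleGraph.IsIndepSet.card_le_indepNum ?_
    rw [Finset.coe_compl]
    exact SimpleGraph.isIndepSet_compl_iff_isVertexCover.2 hC
  have h2 : G.vertexCoverNum ≤ (Iᶜ).card := by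
    refine vertexCoverNum_le_card ?_
    rw [Finset.coe_compl]
    exact SimpleGraph.isVertexCover_compl.2 hI.1
  rw [← hcard] at h2 ⊢
  have h2 : C.card ≤ (Iᶜ).card := by exact_mod_cast h2
  rw [Finset.card_compl, Fintype.card_fin] at h1 h2
  have h3 := Finset.card_le_univ C
  have h4 := Finset.card_le_univ I
  rw [Fintype.card_fin] at h3 h4
  have : C.card + G.indepNum = n := by omega
  exact_mod_cast this

theorem isUnfrozen_indepNum_iff {n : ℕ} (G : SimpleGraph (Fin n)) :
    IsUnfrozen SimpleGraph.indepNum G ↔ IsUnfrozen SimpleGraph.vertexCoverNum G := by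
  refine forall₄_congr fun u v _ _ => ?_
  set H := G ⊔ SimpleGraph.edge u v
  have h1 := vertexCoverNum_add_indepNum G
  have h2 := vertexCoverNum_add_indepNum H
  obtain ⟨C, -, hC⟩ := exists_finset_vertexCoverNum G
  obtain ⟨D, -, hD⟩ := exists_finset_vertexCoverNum H
  rw [← hC] at h1 ⊢
  rw [← hD] at h2 ⊢
  norm_cast at h1 h2 ⊢
  omega


/-! ### Checks that report errors -/

namespace TabProg

variable {V A : Type} [DecidableEq V] [DecidableEq A]

/-- The tables in which a program deletes entries. -/
def deletes : TabProg V A → Finset A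
  | skip => ∅
  | set a _ _ b => if b then ∅ else {a}
  | ifTab _ _ _ p q => deletes p ∪ deletes q
  | next pe pf pt => deletes pe ∪ (deletes pf ∪ deletes pt)
  | seq p q => deletes p ∪ deletes q
  | loop _ p => deletes p

/-- No part of the decision procedure deletes from `err`, so an error once reported lasts to the
end. -/
theorem run_tab_of_notMem_deletes (N : ℕ) (p : TabProg V A) {a : A} (h : a ∉ p.deletes) (ρ : V → ℕ)
    (s : Store A) {i j : ℕ} (hs : s.tab a i j = true) : (p.run N ρ s).tab a i j = true := by
  induction p generalizing ρ s with
  | skip => exact hs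
  | set b x y c =>
    cases c
    · have : a ≠ b := by simpa [deletes] using h
      simp [run, Store.set, this, hs]
    · simp [run, Store.set, hs]
  | ifTab b x y p q ihp ihq =>
    simp only [deletes, Finset.mem_union, not_or] at h
    simp only [run]
    split
    · exact ihp h.1 ρ s hs
    · exact ihq h.2 ρ s hs
  | next pe pf pt ihe ihf iht =>
    simp only [deletes, Finset.mem_union, not_or] at h
    simp only [run]
    split
    · exact ihe h.1 ρ s hs
    · exact ihf h.2.1 ρ _ hs
    · exact iht h.2.2 ρ _ hs
  | seq p q ihp ihq =>
    simp only [deletes, Finset.mem_union, not_or] at h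
    exact ihq h.2 ρ _ (ihp h.1 ρ s hs)
  | loop x p ih =>
    exact upTo_induction (fun _ (t : Store A) => t.tab a i j = true) hs fun i _ t ht => ih h _ t ht

end TabProg

/-- Reports an error. -/
def failProg : Prog := .set .err 9 9 true

/-- On tables that agree with those of `s`, except for the errors, the program reports an error
if and only if `C` holds for the values of the variables, and it does nothing else. -/
def IsCheck (N : ℕ) (s : Store Tab) (p : Prog) (C : (Fin 10 → ℕ) → Prop) : Prop :=
  ∀ ρ, ρ 9 = 0 → ∀ t : Store Tab, (∀ a, a ≠ .err → t.tab a = s.tab a) →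
    (∀ a, a ≠ .err → (p.run N ρ t).tab a = s.tab a) ∧
      ((p.run N ρ t).tab .err 0 0 = true ↔ t.tab .err 0 0 = true ∨ C ρ)

section

variable {N : ℕ} {s : Store Tab} {p q : Prog} {C D : (Fin 10 → ℕ) → Prop}

theorem isCheck_skip : IsCheck N s .skip fun _ => False :=
  fun _ _ _ ht => ⟨ht, by simp [run]⟩

/-- The variable `9` always has the value `0`, so errors are kept in the entry `(0, 0)`. -/
theorem isCheck_failProg : IsCheck N s failProg fun _ => True := by
  refine fun ρ hρ t ht => ⟨fun a ha => ?_, by simp [failProg, run, Store.set, hρ]⟩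
  rw [← ht a ha]
  funext i j
  simp [failProg, run, Store.set, ha]

/-- Together with the rules for `seq` and `loop`, this derives the condition of a check from its
syntax. Tests of `err` are excluded, since that table need not agree with the one of `s`. -/
theorem IsCheck.ifTab (hp : IsCheck N s p C) (hq : IsCheck N s q D) {a : Tab} (ha : a ≠ .err)
    (x y : Fin 10) : IsCheck N s (.ifTab a x y p q) fun ρ =>
      if s.tab a (ρ x) (ρ y) = true then C ρ else D ρ := by
  intro ρ hρ t ht
  simp only [run, ht a ha]
  split
  · exact hp ρ hρ t ht
  · exact hq ρ hρ t ht

theorem IsCheck.seq (hp : IsCheck N s p C) (hq : IsCheck N s q D) :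
    IsCheck N s (.seq p q) fun ρ => C ρ ∨ D ρ := by
  intro ρ hρ t ht
  obtain ⟨h1, h2⟩ := hp ρ hρ t ht
  obtain ⟨h3, h4⟩ := hq ρ hρ _ h1
  exact ⟨h3, by rw [← or_assoc, ← h2]; exact h4⟩

theorem IsCheck.loop (hp : IsCheck N s p C) {x : Fin 10} (hx : 9 ≠ x) :
    IsCheck N s (.loop x p) fun ρ => ∃ i < N, C (Function.update ρ x i) := by
  intro ρ hρ t ht
  refine upTo_induction (fun i (u : Store Tab) => (∀ a, a ≠ .err → u.tab a = s.tab a) ∧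
    (u.tab .err 0 0 = true ↔ t.tab .err 0 0 = true ∨ ∃ k < i, C (Function.update ρ x k)))
    ⟨ht, by simp⟩ ?_
  rintro i - u ⟨h1, h2⟩
  obtain ⟨h3, h4⟩ := hp (Function.update ρ x i) (by simp [Function.update_of_ne hx, hρ]) u h1
  refine ⟨h3, h4.trans ?_⟩
  rw [h2, or_assoc]
  simp only [Nat.lt_succ_iff_lt_or_eq, or_and_right, exists_or, exists_eq_left]

end

/-- Checks that a table is the adjacency matrix of a graph. -/
def graphProg : Prog :=
  .loop 0 (.loop 1 (.ifTab .adj 0 1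
    (.seq (.ifTab .adj 0 0 failProg .skip) (.ifTab .adj 1 0 .skip failProg)) .skip))

theorem isCheck_graphProg (N : ℕ) (s : Store Tab) : IsCheck N s graphProg fun _ =>
    ∃ i < N, ∃ j < N, s.tab .adj i j = true ∧ (s.tab .adj i i = true ∨ s.tab .adj j i = false) := by
  have h := (((((isCheck_failProg (N := N) (s := s)).ifTab isCheck_skip (a := .adj)
    (by simp) 0 0).seq (isCheck_skip.ifTab isCheck_failProg (a := .adj) (by simp) 1 0)).ifTab isCheck_skip
    (a := .adj) (by simp) 0 1).loop (x := 1) (by decide)).loop (x := 0) (by decide)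
  intro ρ hρ t ht
  refine ⟨(h ρ hρ t ht).1, (h ρ hρ t ht).2.trans ?_⟩
  simp [Function.update]

/-- Checks that no edge joins two vertices with an even walk between them. -/
def oddProg : Prog :=
  .loop 0 (.loop 1 (.ifTab .adj 0 1 (.ifTab .even 0 1 failProg .skip) .skip))

theorem isCheck_oddProg (N : ℕ) (s : Store Tab) : IsCheck N s oddProg fun _ =>
    ∃ i < N, ∃ j < N, s.tab .adj i j = true ∧ s.tab .even i j = true := by
  have h := ((((isCheck_failProg (N := N) (s := s)).ifTab isCheck_skip (a := .even) (by simp)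
    0 1).ifTab isCheck_skip (a := .adj) (by simp) 0 1).loop (x := 1) (by decide)).loop
    (x := 0) (by decide)
  intro ρ hρ t ht
  refine ⟨(h ρ hρ t ht).1, (h ρ hρ t ht).2.trans ?_⟩
  simp [Function.update]

/-- Carries out a check for all nonedges. -/
def nonedgeProg (p : Prog) : Prog :=
  .loop 0 (.loop 1 (.ifTab .vert 0 0 (.ifTab .vert 1 1 (.ifTab .vert 0 1 .skip
    (.ifTab .adj 0 1 .skip p)) .skip) .skip))

/-- As `vert` will hold the vertices on its diagonal and nothing else, its entry at `(i, j)` serves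
as a test for `i = j`. -/
theorem IsCheck.nonedgeProg {N : ℕ} {s : Store Tab} {p : Prog} {C : (Fin 10 → ℕ) → Prop}
    (hp : IsCheck N s p C) : IsCheck N s (nonedgeProg p) fun ρ =>
      ∃ i < N, ∃ j < N, s.tab .vert i i = true ∧ s.tab .vert j j = true ∧ s.tab .vert i j = false ∧
        s.tab .adj i j = false ∧ C (Function.update (Function.update ρ 0 i) 1 j) := by
  have h := ((((isCheck_skip.ifTab (isCheck_skip.ifTab hp (a := .adj) (by simp) 0 1)
    (a := .vert) (by simp)
    0 1).ifTab isCheck_skip (a := .vert) (by simp) 1 1).ifTab isCheck_skip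
    (a := .vert) (by simp) 0 0).loop (x := 1) (by decide)).loop (x := 0) (by decide)
  intro ρ hρ t ht
  refine ⟨(h ρ hρ t ht).1, (h ρ hρ t ht).2.trans ?_⟩
  simp [Function.update]


/-! ### Even walks and bipartiteness -/

/-- The number of entries of the table `even`. -/
def evenSum (N : ℕ) (s : Store Tab) : ℕ :=
  ((Finset.range N ×ˢ Finset.range N).filter fun x => s.tab .even x.1 x.2 = true).card

theorem evenSum_le (N : ℕ) (s : Store Tab) : evenSum N s ≤ N * N := by
  refine (Finset.card_filter_le _ _).trans ?_
  simp

theorem evenSum_lt_set {N : ℕ} {s : Store Tab} {i j : ℕ} (hi : i < N) (hj : j < N)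
    (h : s.tab .even i j = false) : evenSum N s < evenSum N (s.set .even i j true) := by
  refine Finset.card_lt_card ⟨fun x hx => ?_, fun hc => ?_⟩
  · simp only [Finset.mem_filter] at hx ⊢
    exact ⟨hx.1, by simp [Store.set, hx.2]⟩
  · have := hc (x := (i, j)) (by simp [hi, hj, Store.set])
    simp [h] at this

/-- The program keeps `I`, either makes progress or does nothing, and does nothing if and only if
`Q` holds. -/
def Grows (N : ℕ) (I : Store Tab → Prop) (p : Prog) (ρ : Fin 10 → ℕ) (Q : Store Tab → Prop) :
    Prop :=
  ∀ s, I s → I (p.run N ρ s) ∧ (p.run N ρ s = s ∨ evenSum N s < evenSum N (p.run N ρ s)) ∧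
    (p.run N ρ s = s ↔ Q s)

/-- A first change makes `evenSum` larger for good, so the state cannot come back. Hence the loop
does nothing exactly if no round does anything in the initial state, and a fixed point of nested
loops is a state closed under all the updates. -/
theorem Grows.loop {N : ℕ} {I : Store Tab → Prop} {p : Prog} {ρ : Fin 10 → ℕ} {x : Fin 10}
    {Q : ℕ → Store Tab → Prop} (h : ∀ i < N, Grows N I p (Function.update ρ x i) (Q i)) :
    Grows N I (.loop x p) ρ fun s => ∀ i < N, Q i s := by
  intro s hs
  refine upTo_induction (fun i (t : Store Tab) => I t ∧ (t = s ∨ evenSum N s < evenSum N t) ∧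
    (t = s ↔ ∀ k < i, Q k s)) (by simp [hs]) ?_
  rintro i hi t ⟨h1, h2, h3⟩
  obtain ⟨h4, h5, h6⟩ := h i hi t h1
  have e : (∀ k < i + 1, Q k s) ↔ (∀ k < i, Q k s) ∧ Q i s := by
    simp only [Nat.lt_succ_iff_lt_or_eq, or_imp, forall_and, forall_eq]
  rw [e, ← h3]
  by_cases ht : t = s
  · subst ht
    exact ⟨h4, h5, by simpa using h6⟩
  · have h7 := h2.resolve_left ht
    have h8 : evenSum N s < evenSum N (p.run N (Function.update ρ x i) t) := by
      rcases h5 with h5 | h5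
      · rwa [h5]
      · exact h7.trans h5
    refine ⟨h4, .inr h8, fun hc => ?_, fun hc => absurd hc.1 ht⟩
    rw [hc] at h8
    exact absurd h8 (lt_irrefl _)

/-- Extends all even walks by two edges. -/
def evenRound : Prog :=
  .loop 0 (.loop 1 (.loop 2 (.loop 3
    (.ifTab .even 0 1 (.ifTab .adj 1 2 (.ifTab .adj 2 3 (.set .even 0 3 true) .skip) .skip) .skip))))

/-- Finds the pairs of vertices that are joined by even walks. -/
def evenProg : Prog := .seq (.loop 0 (.set .even 0 0 true)) (often evenRound)

/-- What is true about even walks when they have been found partially. -/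
structure EvenValid {n : ℕ} (N : ℕ) (G : SimpleGraph (Fin n)) (s : Store Tab) : Prop where
  adj_eq : s.tab .adj = adjTable G
  refl : ∀ i < N, s.tab .even i i = true
  sound : ∀ i j : Fin n, s.tab .even i j = true → ∃ w : G.Walk i j, Even w.length
  small : s.Small N

variable {n N : ℕ} {G : SimpleGraph (Fin n)} {s : Store Tab} {ρ : Fin 10 → ℕ}

theorem EvenValid.set (h : EvenValid N G s) {i j k l : ℕ} (hi : i < N) (hl : l < N)
    (h1 : s.tab .even i j = true) (h2 : s.tab .adj j k = true) (h3 : s.tab .adj k l = true) :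
    EvenValid N G (s.set .even i l true) := by
  refine ⟨?_, fun a ha => ?_, fun a b hab => ?_, fun t a b hab => ?_⟩
  · rw [← h.adj_eq]
    funext a b
    simp [Store.set]
  · simp [Store.set, h.refl a ha]
  · simp only [Store.set, true_and] at hab
    split at hab
    next hc =>
      obtain ⟨rfl, rfl⟩ := hc
      rw [h.adj_eq, adjTable_iff] at h2 h3
      obtain ⟨hj, hk, h2⟩ := h2
      obtain ⟨_, _, h3⟩ := h3
      obtain ⟨w, hw⟩ := h.sound a ⟨j, hj⟩ h1
      refine ⟨(w.concat h2).concat h3, ?_⟩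
      simp only [SimpleGraph.Walk.length_concat]
      exact (hw.add_one).add_one
    next => exact h.sound a b hab
  · simp only [Store.set] at hab
    split at hab
    next hc => rw [hc.2.1, hc.2.2]; exact ⟨hi, hl⟩
    next => exact h.small t a b hab

theorem grows_evenRound : Grows N (EvenValid N G) evenRound ρ fun s => ∀ i < N, ∀ j < N, ∀ k < N,
    ∀ l < N, s.tab .even i j = true → s.tab .adj j k = true → s.tab .adj k l = true →
      s.tab .even i l = true := by
  refine .loop fun i hi => .loop fun j hj => .loop fun k hk => .loop fun l hl s hs => ?_
  simp only [run, Function.update, Fin.reduceEq, eq_rec_constant, dite_eq_ite, if_true, if_false]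
  by_cases h1 : s.tab .even i j = true
  · by_cases h2 : s.tab .adj j k = true
    · by_cases h3 : s.tab .adj k l = true
      · simp only [h1, h2, h3, if_true, true_imp_iff]
        refine ⟨hs.set hi hl h1 h2 h3, ?_, fun hc => ?_, fun hc => ?_⟩
        · by_cases h4 : s.tab .even i l = true
          · left
            ext t a b
            · simp only [Store.set]
              split
              next hc => rw [hc.1, hc.2.1, hc.2.2, h4]
              next => rfl
            · rfl
          · exact .inr (evenSum_lt_set hi hl (by simpa using h4))
        · rw [← hc]
          simp [Store.set]
        · ext t a b
          · simp only [Store.set]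
            split
            next hd => rw [hd.1, hd.2.1, hd.2.2, hc]
            next => rfl
          · rfl
      · simp [h1, h2, h3, hs]
    · simp [h1, h2, hs]
  · simp [h1, hs]

theorem run_evenProg (hN : 2 ≤ N) (hn : n ≤ N) (hρ : ∀ x, ρ x < N) (hs : s.Small N)
    (hadj : s.tab .adj = adjTable G) (heven : ∀ i j, s.tab .even i j = false) (i j : Fin n) :
    (evenProg.run N ρ s).tab .even i j = true ↔ ∃ w : G.Walk i j, Even w.length := by
  set p : Prog := .loop 0 (.set .even 0 0 true)
  set t := p.run N ρ s with ht
  have hp : ∀ a b, t.tab .even a b = true ↔ a = b ∧ a < N := by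
    refine upTo_induction (fun i (t : Store Tab) => ∀ a b, t.tab .even a b = true ↔ a = b ∧ a < i)
      (by simp [heven]) fun i hi t ih a b => ?_
    simp only [run, Store.set, Function.update_self, true_and]
    split
    next hc => simp [hc.1, hc.2]
    next hc =>
      rw [ih]
      constructor
      · exact fun h => ⟨h.1, by omega⟩
      · exact fun h => ⟨h.1, by omega⟩
  have hv : EvenValid N G t := by
    refine ⟨?_, fun a ha => (hp a a).2 ⟨rfl, ha⟩, fun a b hab => ?_, run_small N p ρ hρ s hs⟩
    · rw [← hadj]
      exact run_tab_of_notMem N p (by decide) ρ s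
    · obtain rfl := Fin.ext ((hp a b).1 hab).1
      exact ⟨.nil, by simp⟩
  obtain ⟨h1, h2⟩ := run_often (ρ := ρ) evenRound (EvenValid N G) (fun s => ∀ i < N, ∀ j < N,
    ∀ k < N, ∀ l < N, s.tab .even i j = true → s.tab .adj j k = true → s.tab .adj k l = true →
      s.tab .even i l = true) (evenSum N) hN (fun ρ s hs => by
      obtain ⟨h1, h2, h3⟩ := grows_evenRound (ρ := ρ) s hs
      refine ⟨h1, fun hc => by rwa [h3.2 hc], ?_⟩
      rcases h2 with h2 | h2
      · left
        rw [h2]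
        exact h3.1 h2
      · exact .inr h2) (evenSum_le N) hv
  refine ⟨h1.sound i j, fun ⟨w, hw⟩ => ?_⟩
  -- Completeness by induction on half the length: removing the last two edges leaves a shorter even
  -- walk, and the final table is closed under adding two edges.
  have key : ∀ m, ∀ a b : Fin n, ∀ w : G.Walk a b, w.length = m + m →
      ((often evenRound).run N ρ t).tab .even a b = true := by
    intro m
    induction m with
    | zero =>
      intro a b w hw
      obtain rfl := SimpleGraph.Walk.eq_of_length_eq_zero hw
      exact h1.refl a (a.2.trans_le hn)
    | succ m ih =>
      intro a b w hw
      obtain ⟨c, hc, hw'⟩ : ∃ c, G.Adj c b ∧ ∃ w' : G.Walk a c, w'.length = m + m + 1 :=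
        ⟨_, w.adj_penultimate (by rw [← SimpleGraph.Walk.length_eq_zero_iff]; omega), w.dropLast,
          by simp; omega⟩
      obtain ⟨w', hw'⟩ := hw'
      have hn' : ¬ w'.Nil := by rw [← SimpleGraph.Walk.length_eq_zero_iff]; omega
      have h3 := ih a w'.penultimate w'.dropLast (by simp; omega)
      have h4 := w'.adj_penultimate hn'
      refine h2 a (a.2.trans_le hn) w'.penultimate (w'.penultimate.2.trans_le hn) c
        (c.2.trans_le hn) b (b.2.trans_le hn) h3 ?_ ?_
      · rw [h1.adj_eq, adjTable_val]; exact h4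
      · rw [h1.adj_eq, adjTable_val]; exact hc
  obtain ⟨m, hm⟩ := hw
  exact key m i j w hm

/-- An odd closed walk is an edge followed by an even walk between its ends. -/
theorem isBipartite_iff (G : SimpleGraph (Fin n)) : G.IsBipartite ↔
    ¬ ∃ i j, G.Adj i j ∧ ∃ w : G.Walk i j, Even w.length := by
  rw [SimpleGraph.IsBipartite, SimpleGraph.two_colorable_iff_forall_loop_even]
  constructor
  · rintro h ⟨i, j, hij, w, hw⟩
    have := h j (.cons hij.symm w)
    rw [SimpleGraph.Walk.length_cons, Nat.even_add_one] at this
    exact this hw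
  · intro h i w
    by_contra hc
    cases w with
    | nil => simp at hc
    | cons hij w =>
      rw [SimpleGraph.Walk.length_cons, Nat.even_add_one, not_not] at hc
      exact h ⟨_, _, hij.symm, w, hc⟩


/-! ### Reading the input -/

/-- Reads the number of vertices. -/
def headProg : Prog :=
  .loop 0 (.ifTab .ended 9 9 .skip
    (.next failProg (.set .ended 9 9 true) (.set .vert 0 0 true)))

/-- Reads the adjacency matrix. -/
def matrixProg : Prog :=
  .loop 0 (.ifTab .vert 0 0 (.loop 1 (.ifTab .vert 1 1
    (.next failProg .skip (.set .adj 0 1 true)) .skip)) .skip)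

/-- Checks that the input ends. -/
def endProg : Prog := .next .skip failProg failProg

/-- Reads the input. -/
def parseProg : Prog := .seq headProg (.seq matrixProg endProg)

/-- The state at the beginning. -/
def initStore (w : List Bool) : Store Tab := ⟨fun _ _ _ => false, w⟩

/-- The state after reading the number of vertices. -/
def headStore (n : ℕ) (r : List Bool) : Store Tab where
  tab
    | .vert, i, j => decide (i = j ∧ i < n)
    | .ended, i, j => decide (i = 0 ∧ j = 0)
    | _, _, _ => false
  inp := r

/-- The state after reading the first `c` entries of the matrix. -/
def matrixStore (n : ℕ) (r : List Bool) (c : ℕ) : Store Tab where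
  tab
    | .adj, i, j => decide (j < n ∧ i * n + j < c ∧ r[i * n + j]? = some true)
    | a, i, j => (headStore n r).tab a i j
  inp := r.drop c

theorem run_headProg (w : List Bool) :
    (∃ n r, w = List.replicate n true ++ false :: r ∧
      headProg.run (w.length + 1) (fun _ => 0) (initStore w) = headStore n r) ∨
    false ∉ w ∧ (headProg.run (w.length + 1) (fun _ => 0) (initStore w)).tab .err 0 0 = true := by
  have := upTo_induction (f := fun i s => TabProg.run (w.length + 1) (.ifTab .ended 9 9 .skip
    (.next failProg (.set .ended 9 9 true) (.set .vert 0 0 true)))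
    (Function.update (fun _ : Fin 10 => 0) 0 i) s) (s := initStore w) (n := w.length + 1)
    (fun i (t : Store Tab) =>
      (∃ n r, w = List.replicate n true ++ false :: r ∧ t = headStore n r) ∨
      (false ∉ w ∧ t.tab .err 0 0 = true) ∨
      ∃ r, w = List.replicate i true ++ r ∧
        t = ⟨fun a x y => match a with
          | .vert => decide (x = y ∧ x < i)
          | _ => false, r⟩) ?_ ?_
  · rcases this with h | h | ⟨r, h, -⟩
    · exact .inl h
    · exact .inr h
    -- Reading only `true` in all `w.length + 1` rounds would need a longer word.
    · have := congrArg List.length h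
      simp at this
      omega
  · refine .inr (.inr ⟨w, rfl, ?_⟩)
    ext a x y
    · cases a <;> simp [initStore]
    · rfl
  · rintro i - t (⟨n, r, hw, rfl⟩ | ⟨hw, ht⟩ | ⟨r, hw, rfl⟩)
    · refine .inl ⟨n, r, hw, ?_⟩
      simp [run, headStore, Function.update_of_ne]
    · exact .inr (.inl ⟨hw, run_tab_of_notMem_deletes _ _ (by decide) _ _ ht⟩)
    · rcases r with - | ⟨b, r⟩
      · refine .inr (.inl ⟨?_, ?_⟩)
        · simp [hw]
        · simp [run, failProg, Store.set]
      · cases b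
        · refine .inl ⟨i, r, hw, ?_⟩
          ext a x y
          · cases a <;> simp [run, headStore, Store.set]
          · simp [run, headStore, Store.set]
        · refine .inr (.inr ⟨r, ?_, ?_⟩)
          · rw [hw, List.replicate_succ']
            simp
          · ext a x y
            · cases a <;> simp [run, Store.set]
              rw [Bool.eq_iff_iff]
              simp only [Bool.or_eq_true, Bool.and_eq_true, decide_eq_true_eq]
              omega
            · simp [run, Store.set]

theorem matrixStore_zero (n : ℕ) (r : List Bool) : matrixStore n r 0 = headStore n r := by
  ext a i j
  · cases a <;> simp [matrixStore, headStore]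
  · simp [matrixStore, headStore]

theorem matrixStore_succ {n : ℕ} {r : List Bool} {i j : ℕ} (hj : j < n) (b : Bool) (l : List Bool)
    (h : r.drop (i * n + j) = b :: l) : matrixStore n r (i * n + (j + 1)) =
      ⟨((matrixStore n r (i * n + j)).set .adj i j b).tab, l⟩ := by
  have hb : r[i * n + j]? = some b := by
    rw [← List.head?_drop, h]; rfl
  have hl : r.drop (i * n + (j + 1)) = l := by
    rw [← add_assoc, ← List.drop_drop, h]; rfl
  ext a x y
  · cases a <;> simp [matrixStore, headStore, Store.set]
    by_cases hxy : x = i ∧ y = j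
    · obtain ⟨rfl, rfl⟩ := hxy
      simp [hj, hb]
    · rw [if_neg hxy]
      rw [Bool.eq_iff_iff]
      simp only [Bool.and_eq_true, decide_eq_true_eq]
      refine and_congr_right fun hy => and_congr_left fun _ => ⟨fun hc => ?_, by omega⟩
      -- As both columns are smaller than `n`, the position `i * n + j` determines row and column.
      refine lt_of_le_of_ne (by omega) fun he => hxy ?_
      have hn : 0 < n := by omega
      have h1 : (x * n + y) % n = (i * n + j) % n := by rw [he]
      rw [Nat.mul_add_mod', Nat.mul_add_mod', Nat.mod_eq_of_lt hy, Nat.mod_eq_of_lt hj] at h1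
      refine ⟨?_, h1⟩
      rw [h1] at he
      exact Nat.eq_of_mul_eq_mul_right hn (by omega)
  · simp [matrixStore, hl]

theorem run_matrixProg {n N : ℕ} (hn : n ≤ N) (r : List Bool) {ρ : Fin 10 → ℕ} (hρ : ρ 9 = 0) :
    (n * n ≤ r.length ∧ matrixProg.run N ρ (headStore n r) = matrixStore n r (n * n)) ∨
    (r.length < n * n ∧ (matrixProg.run N ρ (headStore n r)).tab .err 0 0 = true) := by
  have vert : ∀ c i, (matrixStore n r c).tab .vert i i = true ↔ i < n := by
    simp [matrixStore, headStore]
  have row : ∀ i < n, ∀ ρ : Fin 10 → ℕ, ρ 9 = 0 → ρ 0 = i →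
      ∀ t : Store Tab, ((i * n ≤ r.length ∧ t = matrixStore n r (i * n)) ∨
      (r.length < i * n ∧ t.tab .err 0 0 = true)) →
      (((i + 1) * n ≤ r.length ∧ (TabProg.loop 1 (.ifTab .vert 1 1
        (.next failProg .skip (.set .adj 0 1 true)) .skip)).run N ρ t =
          matrixStore n r ((i + 1) * n)) ∨
      (r.length < (i + 1) * n ∧ ((TabProg.loop 1 (.ifTab .vert 1 1
        (.next failProg .skip (.set .adj 0 1 true)) .skip)).run N ρ t).tab .err 0 0 = true)) := by
    intro i hi ρ hρ hρ' t ht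
    -- Rounds from `n` on are idle because `vert` is `false` there, so after `j` rounds `min j n`
    -- entries of the row have been read.
    have := upTo_induction (f := fun j s => TabProg.run N (.ifTab .vert 1 1
        (.next failProg .skip (.set .adj 0 1 true)) .skip) (Function.update ρ 1 j) s) (s := t)
        (n := N) (fun j (u : Store Tab) =>
        (i * n + min j n ≤ r.length ∧ u = matrixStore n r (i * n + min j n)) ∨
        (r.length < i * n + min j n ∧ u.tab .err 0 0 = true)) (by simpa using ht) ?_
    · rwa [min_eq_right hn, ← Nat.succ_mul] at this
    · rintro j - u (⟨h, rfl⟩ | ⟨h, hu⟩)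
      · by_cases hj : j < n
        · rw [min_eq_left hj.le] at h ⊢
          rw [min_eq_left (Nat.succ_le_of_lt hj)]
          have hinp : (matrixStore n r (i * n + j)).inp = r.drop (i * n + j) := rfl
          simp only [run, Function.update_self, vert, hj, if_true]
          rcases hd : r.drop (i * n + j) with - | ⟨b, l⟩
          · right
            rw [hinp, hd]
            rw [List.drop_eq_nil_iff] at hd
            exact ⟨by omega, by simp [failProg, run, Store.set, hρ]⟩
          · left
            have hlen : i * n + (j + 1) ≤ r.length := by
              have := congrArg List.length hd
              simp at this
              omega
            refine ⟨hlen, ?_⟩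
            rw [matrixStore_succ hj b l hd, hinp, hd]
            cases b
            · ext a x y
              · simp only [Store.set]
                split
                next hc =>
                  rw [hc.1, hc.2.1, hc.2.2]
                  simp [matrixStore]
                next => rfl
              · rfl
            · simp [Store.set, hρ', Function.update_of_ne]
        · rw [min_eq_right (by omega)] at h ⊢
          rw [min_eq_right (by omega)]
          simp only [run, Function.update_self, vert, hj, if_false]
          exact .inl ⟨h, by simp⟩
      · exact .inr ⟨by omega, run_tab_of_notMem_deletes _ _ (by decide) _ _ hu⟩
  have := upTo_induction (f := fun i s => TabProg.run N (.ifTab .vert 0 0 (.loop 1 (.ifTab .vert 1 1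
    (.next failProg .skip (.set .adj 0 1 true)) .skip)) .skip) (Function.update ρ 0 i) s)
    (s := headStore n r) (n := N) (fun i (u : Store Tab) => (min i n * n ≤ r.length ∧
      u = matrixStore n r (min i n * n)) ∨ (r.length < min i n * n ∧ u.tab .err 0 0 = true))
    (by simp [matrixStore_zero]) ?_
  · rwa [min_eq_right hn] at this
  · rintro i - u hu
    by_cases hi : i < n
    · rw [min_eq_left hi.le] at hu
      rw [min_eq_left (Nat.succ_le_of_lt hi)]
      simp only [run, Function.update_self]
      split
      next =>
        exact row i hi _ (by simp [hρ]) (by simp) u hu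
      next hc =>
        rcases hu with ⟨h, rfl⟩ | ⟨h, hu⟩
        · simp only [vert] at hc
          exact absurd hi hc
        · exact .inr ⟨h.trans_le (Nat.mul_le_mul_right _ (Nat.le_succ i)), hu⟩
    · rw [min_eq_right (by omega)] at hu ⊢
      rcases hu with ⟨h, rfl⟩ | ⟨h, hu⟩
      · simp only [run, Function.update_self, vert, hi, if_false]
        exact .inl ⟨h, by simp⟩
      · exact .inr ⟨h, run_tab_of_notMem_deletes _ _ (by decide) _ _ hu⟩

theorem replicate_append_inj {m n : ℕ} {s t : List Bool}
    (h : List.replicate m true ++ false :: s = List.replicate n true ++ false :: t) :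
    m = n ∧ s = t := by
  induction m generalizing n with
  | zero => cases n <;> simp_all [List.replicate_succ]
  | succ m ih =>
    cases n with
    | zero => simp [List.replicate_succ] at h
    | succ n =>
      simp only [List.replicate_succ, List.cons_append, List.cons.injEq, true_and] at h
      simpa using ih h

theorem run_parseProg (w : List Bool) :
    (∃ n r, w = List.replicate n true ++ false :: r ∧ r.length = n * n ∧
      parseProg.run (w.length + 1) (fun _ => 0) (initStore w) = matrixStore n r (n * n)) ∨
    (∀ n r, w = List.replicate n true ++ false :: r → r.length ≠ n * n) ∧
      (parseProg.run (w.length + 1) (fun _ => 0) (initStore w)).tab .err 0 0 = true := by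
  set N := w.length + 1
  rw [show parseProg.run N (fun _ => 0) (initStore w) = endProg.run N (fun _ => 0)
    (matrixProg.run N (fun _ => 0) (headProg.run N (fun _ => 0) (initStore w))) from rfl]
  rcases run_headProg w with ⟨n, r, hw, h⟩ | ⟨hw, h⟩
  · rw [h]
    have hn : n ≤ N := by simp [N, hw]; omega
    have huniq : r.length ≠ n * n →
        ∀ m r', w = List.replicate m true ++ false :: r' → r'.length ≠ m * m := by
      rintro hr m r' hm
      obtain ⟨rfl, rfl⟩ := replicate_append_inj (hw.symm.trans hm)
      exact hr
    rcases run_matrixProg hn r (ρ := fun _ => 0) rfl with ⟨h1, h2⟩ | ⟨h1, h2⟩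
    · rw [h2]
      rcases hd : r.drop (n * n) with - | ⟨b, l⟩
      · refine .inl ⟨n, r, hw, ?_, ?_⟩
        · rw [List.drop_eq_nil_iff] at hd
          exact le_antisymm hd h1
        · have : (matrixStore n r (n * n)).inp = [] := hd
          simp [endProg, run, this]
      · refine .inr ⟨huniq fun hc => ?_, ?_⟩
        · rw [← hc, List.drop_length] at hd
          cases hd
        · have : (matrixStore n r (n * n)).inp = b :: l := hd
          cases b <;> simp [endProg, run, this, failProg, Store.set]
    · exact .inr ⟨huniq h1.ne, run_tab_of_notMem_deletes _ _ (by decide) _ _ h2⟩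
  · refine .inr ⟨fun m r' hm => ?_, run_tab_of_notMem_deletes _ _ (by decide) _ _
      (run_tab_of_notMem_deletes _ _ (by decide) _ _ h)⟩
    simp [hm] at hw


/-! ### Correctness of the decision procedure -/

theorem getElem?_flatMap_of_length_eq {α β : Type*} {n : ℕ} {f : α → List β}
    (hf : ∀ a, (f a).length = n) (l : List α) (i : ℕ) {j : ℕ} (hj : j < n) :
    (l.flatMap f)[i * n + j]? = l[i]?.bind fun a => (f a)[j]? := by
  induction l generalizing i with
  | nil => simp
  | cons a l ih =>
    rw [List.flatMap_cons]
    cases i with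
    | zero => simp [List.getElem?_append, hf, hj]
    | succ i =>
      rw [Nat.succ_mul, List.getElem?_append, hf, if_neg (by omega),
        show i * n + n + j - n = i * n + j by omega, ih]
      simp

theorem exists_encodeGraph_eq {n : ℕ} (G : SimpleGraph (Fin n)) :
    ∃ r, encodeGraph G = List.replicate n true ++ false :: r ∧ r.length = n * n ∧
      ∀ i j, j < n → (r[i * n + j]? = some true ↔ adjTable G i j = true) := by
  classical
  refine ⟨_, rfl, by simp [List.length_flatMap], fun i j hj => ?_⟩
  rw [getElem?_flatMap_of_length_eq (fun a => by simp) _ _ hj, adjTable_iff]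
  by_cases hi : i < n <;> simp [hi, hj]

theorem matrixStore_adj {n : ℕ} {r : List Bool} {i j : ℕ} (hr : r.length = n * n) :
    (matrixStore n r (n * n)).tab .adj i j = true ↔ j < n ∧ r[i * n + j]? = some true := by
  have : r[i * n + j]? = some true → i * n + j < n * n := by
    intro h
    rw [← hr]
    exact (List.getElem?_eq_some_iff.1 h).1
  simp only [matrixStore, decide_eq_true_eq]
  tauto

/-- For a matrix of the right length, the table read from it determines all its symbols, since each
position `c` is the entry `(c / n, c % n)`. -/
theorem encodeGraph_eq_iff {n : ℕ} {r : List Bool} (hr : r.length = n * n)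
    (G : SimpleGraph (Fin n)) : encodeGraph G = List.replicate n true ++ false :: r ↔
      (matrixStore n r (n * n)).tab .adj = adjTable G := by
  obtain ⟨r', h1, h2, h3⟩ := exists_encodeGraph_eq G
  constructor
  · intro h
    obtain ⟨-, rfl⟩ := replicate_append_inj (h1.symm.trans h)
    funext i j
    rw [Bool.eq_iff_iff, matrixStore_adj hr]
    constructor
    · exact fun hc => (h3 i j hc.1).1 hc.2
    · intro hc
      obtain ⟨-, hj, -⟩ := (adjTable_iff G i j).1 hc
      exact ⟨hj, (h3 i j hj).2 hc⟩
  · intro h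
    rw [h1]
    congr 2
    refine List.ext_getElem (by rw [h2, hr]) fun c hc hc' => ?_
    have hn : 0 < n := by
      rcases Nat.eq_zero_or_pos n with rfl | hn
      · omega
      · exact hn
    have hj := Nat.mod_lt c hn
    have e : c / n * n + c % n = c := Nat.div_add_mod' c n
    have h4 := h3 (c / n) (c % n) hj
    have h5 := matrixStore_adj (i := c / n) (j := c % n) hr
    rw [h, ← h4, e, List.getElem?_eq_getElem hc, List.getElem?_eq_getElem hc'] at h5
    rw [Bool.eq_iff_iff]
    simpa [hj] using h5

/-- Decides whether the input is a bipartite graph whose nonedges pass a check. -/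
def decideProg (p : Prog) : Prog :=
  .seq parseProg (.seq graphProg (.seq evenProg (.seq oddProg (.seq critProg
    (.seq (nonedgeProg p) (.ifTab .err 9 9 .skip (.set .ok 9 9 true)))))))

/-- The relation `R` tells from the spared ends of a nonedge that the nonedge violates the property;
`ok` is set if no error of any kind was reported. -/
theorem run_decideProg {p : Prog} {R : Prop → Prop → Prop} {Q : ∀ n, SimpleGraph (Fin n) → Prop}
    (hp : ∀ N s, IsCheck N s p fun ρ =>
      R (s.tab .crit (ρ 0) (ρ 0) = true) (s.tab .crit (ρ 1) (ρ 1) = true))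
    (hQ : ∀ n G, Q n G ↔ ∀ u v, u ≠ v → ¬ G.Adj u v → ¬ R (Spared G u) (Spared G v))
    (w : List Bool) : w ∈ bipartiteProblem Q ↔
      ((decideProg p).run (w.length + 1) (fun _ => 0) (initStore w)).tab .ok 0 0 = true := by
  set N := w.length + 1 with hN
  set ρ : Fin 10 → ℕ := fun _ => 0
  have hρ : ∀ x, ρ x < N := fun _ => Nat.succ_pos _
  set t0 := parseProg.run N ρ (initStore w) with ht0
  set t1 := graphProg.run N ρ t0 with ht1
  set t2 := evenProg.run N ρ t1 with ht2
  set t3 := oddProg.run N ρ t2 with ht3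
  set t4 := critProg.run N ρ t3 with ht4
  set t5 := (nonedgeProg p).run N ρ t4 with ht5
  obtain ⟨h5, h5'⟩ := (hp N t4).nonedgeProg ρ rfl t4 fun _ _ => rfl
  rw [← ht5] at h5 h5'
  have hok : t5.tab .ok 0 0 = false := by
    rw [h5 .ok (by simp), ht4, run_tab_of_notMem N _ (by decide), ht3,
      run_tab_of_notMem N _ (by decide), ht2, run_tab_of_notMem N _ (by decide), ht1,
      run_tab_of_notMem N _ (by decide), ht0, run_tab_of_notMem N _ (by decide)]
    rfl
  have hres : ((decideProg p).run N ρ (initStore w)).tab .ok 0 0 = true ↔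
      ¬ t5.tab .err 0 0 = true := by
    change (TabProg.run N (.ifTab .err 9 9 .skip (.set .ok 9 9 true)) ρ t5).tab .ok 0 0 = true ↔ _
    simp only [run, ρ]
    split
    next hc => simp [hok, hc]
    next hc => simp [Store.set, hc]
  rw [hres]
  -- Errors persist, so a failed test may be followed by programs that run on meaningless tables:
  -- the word is rejected anyway.
  have e3 : t3.tab .err 0 0 = true → t5.tab .err 0 0 = true := fun h =>
    h5'.2 (.inl (run_tab_of_notMem_deletes N _ (by decide) _ _ h))
  have e1 : t1.tab .err 0 0 = true → t5.tab .err 0 0 = true := fun h =>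
    e3 (run_tab_of_notMem_deletes N _ (by decide) _ _
      (run_tab_of_notMem_deletes N _ (by decide) _ _ h))
  rcases run_parseProg w with ⟨n, r, hw, hr, h0⟩ | ⟨hw, h0⟩
  swap
  · refine iff_of_false ?_ (not_not.2 (e1 (run_tab_of_notMem_deletes N _ (by decide) _ _ h0)))
    rintro ⟨n, G, -, -, hG⟩
    obtain ⟨r, h1, h2, -⟩ := exists_encodeGraph_eq G
    exact hw n r (hG ▸ h1) h2
  change t0 = _ at h0
  -- The unary number and its end mark are `n + 1` symbols, and `N` exceeds the input length by one:
  -- just enough prices for the pigeonhole argument in `Valid.coverNum_eq`.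
  have hnN : n + 1 < N := by simp [hN, hw]
  obtain ⟨h1, h1'⟩ := isCheck_graphProg N t0 ρ rfl t0 fun _ _ => rfl
  rw [← ht1] at h1 h1'
  have h0e : t0.tab .err 0 0 = false := by rw [h0]; rfl
  by_cases he : t1.tab .err 0 0 = true
  · refine iff_of_false ?_ (not_not.2 (e1 he))
    rintro ⟨m, G, -, -, hG⟩
    obtain ⟨r', h2, -, -⟩ := exists_encodeGraph_eq G
    obtain ⟨rfl, rfl⟩ := replicate_append_inj (h2.symm.trans (hG.trans hw))
    have hA : t0.tab .adj = adjTable G := by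
      rw [h0, ← encodeGraph_eq_iff hr G, h2]
    rw [h1', h0e, hA] at he
    obtain ⟨i, -, j, -, hij, hc⟩ := he.resolve_left (by simp)
    obtain ⟨hi, hj, hadj⟩ := (adjTable_iff G i j).1 hij
    rcases hc with hc | hc
    · obtain ⟨_, _, hc⟩ := (adjTable_iff G i i).1 hc
      exact G.irrefl hc
    · have := (adjTable_iff G j i).2 ⟨hj, hi, hadj.symm⟩
      simp [this] at hc
  have hA : ∀ i j, t0.tab .adj i j = true → i < n ∧ j < n := by
    intro i j hij
    rw [h0, matrixStore_adj hr] at hij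
    refine ⟨?_, hij.1⟩
    have h2 := (List.getElem?_eq_some_iff.1 hij.2).1
    rw [hr] at h2
    by_contra hc
    have := Nat.mul_le_mul_right n (not_lt.1 hc)
    omega
  have hg : ∀ i j, t0.tab .adj i j = true → t0.tab .adj i i = false ∧ t0.tab .adj j i = true := by
    intro i j hij
    have h2 := hA i j hij
    by_contra hc
    refine he (h1'.2 (.inr ⟨i, by omega, j, by omega, hij, ?_⟩))
    by_contra hd
    simp only [not_or, Bool.not_eq_true, Bool.not_eq_false] at hd
    exact hc hd
  let G : SimpleGraph (Fin n) :=
    { Adj := fun i j => t0.tab .adj i j = true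
      symm := ⟨fun i j hij => (hg i j hij).2⟩
      loopless := ⟨fun i hi => by simp [(hg i i hi).1] at hi⟩ }
  have hG : t0.tab .adj = adjTable G := by
    funext i j
    rw [Bool.eq_iff_iff, adjTable_iff]
    exact ⟨fun h => ⟨(hA i j h).1, (hA i j h).2, h⟩, fun ⟨_, _, h⟩ => h⟩
  have henc : encodeGraph G = w := by
    rw [hw, encodeGraph_eq_iff hr, ← h0, hG]
  have hL : w ∈ bipartiteProblem Q ↔ G.IsBipartite ∧ Q n G := by
    constructor
    · rintro ⟨m, H, h2, h3, h4⟩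
      have := encodeGraph_injective (a₁ := ⟨m, H⟩) (a₂ := ⟨n, G⟩) (h4.trans henc.symm)
      cases this
      exact ⟨h2, h3⟩
    · exact fun h => ⟨n, G, h.1, h.2, henc⟩
  rw [hL]
  have hs0 : t0.Small N := run_small N _ ρ hρ _ (by simp [Store.Small, initStore])
  have hs1 : t1.Small N := run_small N _ ρ hρ _ hs0
  have hs3 : t3.Small N := run_small N _ ρ hρ _ (run_small N _ ρ hρ _ hs1)
  have h2 : ∀ a, a ≠ .even → t2.tab a = t1.tab a := fun a ha =>
    run_tab_of_notMem N _ (by revert a; decide) ρ t1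
  have hG1 : t1.tab .adj = adjTable G := by rw [h1 _ (by simp), hG]
  have hG2 : t2.tab .adj = adjTable G := by rw [h2 _ (by simp), hG1]
  have heven : ∀ i j : Fin n, t2.tab .even i j = true ↔ ∃ w : G.Walk i j, Even w.length :=
    run_evenProg (by omega) (by omega) hρ hs1 hG1 fun i j => by
      rw [h1 _ (by simp), h0]; rfl
  obtain ⟨h3, h3'⟩ := isCheck_oddProg N t2 ρ rfl t2 fun _ _ => rfl
  rw [← ht3] at h3 h3'
  have hodd : t3.tab .err 0 0 = true ↔ ¬ G.IsBipartite := by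
    rw [h3', h2 _ (by simp), isBipartite_iff, not_not, hG2]
    constructor
    · rintro (hc | ⟨i, -, j, -, hij, hc⟩)
      · exact absurd hc he
      · obtain ⟨hi, hj, hij⟩ := (adjTable_iff G i j).1 hij
        exact ⟨_, _, hij, (heven ⟨i, hi⟩ ⟨j, hj⟩).1 hc⟩
    · rintro ⟨i, j, hij, hc⟩
      exact .inr ⟨i, by omega, j, by omega, (adjTable_val G i j).2 hij, (heven i j).2 hc⟩
  by_cases hb : G.IsBipartite
  swap
  · exact iff_of_false (fun h => hb h.1) (not_not.2 (e3 (hodd.2 hb)))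
  have hG3 : t3.tab .adj = adjTable G := by rw [h3 _ (by simp), hG2]
  have hG4 : t4.tab .adj = adjTable G := by
    rw [ht4, run_tab_of_notMem N _ (by decide), hG3]
  have he4 : ¬ t4.tab .err 0 0 = true := by
    rw [ht4, run_tab_of_notMem N _ (by decide), hodd, not_not]
    exact hb
  have hv : ∀ i j, t4.tab .vert i j = true ↔ i = j ∧ i < n := by
    intro i j
    rw [ht4, run_tab_of_notMem N _ (by decide), h3 _ (by simp), h2 _ (by simp), h1 _ (by simp), h0]
    simp [matrixStore, headStore]
  have hcrit : ∀ v : Fin n, t4.tab .crit v v = true ↔ Spared G v := by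
    intro v
    rw [spared_iff hb]
    refine run_critProg hnN (fun l r hlr => ?_) hρ hs3 hG3 (fun v => ?_) v (by omega)
    · obtain ⟨hl, hr, -⟩ := (adjTable_iff G l r).1 hlr
      exact ⟨hl, hr⟩
    · rw [h3 _ (by simp), h2 _ (by simp), h1 _ (by simp), h0]
      rfl
  rw [h5', hQ]
  simp only [hb, he4, true_and, false_or, Bool.false_eq_true]
  constructor
  · rintro h ⟨i, -, j, -, hi, hj, hij, hadj, hR⟩
    have hi := ((hv i i).1 hi).2
    have hj := ((hv j j).1 hj).2
    refine h ⟨i, hi⟩ ⟨j, hj⟩ (fun hc => ?_) (fun hc => ?_) ?_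
    · have := (hv i j).2 ⟨congrArg Fin.val hc, hi⟩
      simp [this] at hij
    · rw [← adjTable_val, ← hG4] at hc
      simp [hc] at hadj
    · rw [← hcrit, ← hcrit]
      simpa [Function.update] using hR
  · intro h u v huv hadj hR
    refine h ⟨u, by omega, v, by omega, (hv u u).2 ⟨rfl, u.2⟩, (hv v v).2 ⟨rfl, v.2⟩, ?_, ?_, ?_⟩
    · rw [← Bool.not_eq_true, hv]
      exact fun hc => huv (Fin.ext hc.1)
    · rw [hG4, ← Bool.not_eq_true, adjTable_val]
      exact hadj
    · rw [← hcrit, ← hcrit] at hR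
      simpa [Function.update] using hR

/-! ### The three problems -/

/-- Reports an error if both vertices are marked. -/
def unfrozenProg : Prog := .ifTab .crit 0 0 (.ifTab .crit 1 1 failProg .skip) .skip

/-- Reports an error if one of the vertices is not marked. -/
def frozenProg : Prog := .ifTab .crit 0 0 (.ifTab .crit 1 1 .skip failProg) failProg

theorem isCheck_unfrozenProg (N : ℕ) (s : Store Tab) : IsCheck N s unfrozenProg fun ρ =>
    s.tab .crit (ρ 0) (ρ 0) = true ∧ s.tab .crit (ρ 1) (ρ 1) = true := by
  have h := (((isCheck_failProg (N := N) (s := s)).ifTab isCheck_skip (a := .crit) (by simp)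
    1 1).ifTab isCheck_skip (a := .crit) (by simp) 0 0)
  intro ρ hρ t ht
  refine ⟨(h ρ hρ t ht).1, (h ρ hρ t ht).2.trans ?_⟩
  simp

theorem isCheck_frozenProg (N : ℕ) (s : Store Tab) : IsCheck N s frozenProg fun ρ =>
    ¬ (s.tab .crit (ρ 0) (ρ 0) = true ∧ s.tab .crit (ρ 1) (ρ 1) = true) := by
  have h := (((isCheck_skip (N := N) (s := s)).ifTab isCheck_failProg (a := .crit) (by simp)
    1 1).ifTab isCheck_failProg (a := .crit) (by simp) 0 0)
  intro ρ hρ t ht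
  refine ⟨(h ρ hρ t ht).1, (h ρ hρ t ht).2.trans ?_⟩
  simp only [if_true_right, imp_false]
  tauto

/-- The check `p` runs inside the loops of `nonedgeProg` over the variables `0` and `1`, so its own
loops must avoid these. -/
theorem scoped_decideProg {p : Prog} (hp : p.Scoped {1, 0}) : (decideProg p).Scoped ∅ := by
  simp [decideProg, parseProg, headProg, matrixProg, endProg, failProg, graphProg, evenProg,
    evenRound, often, oddProg, critProg, critBody, resetProg, admitProg, markProg, roundProg,
    passProg, bidProg, nonedgeProg, Scoped, hp]

theorem inP_unfrozen :
    InP (bipartiteProblem fun _ G => IsUnfrozen SimpleGraph.vertexCoverNum G) :=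
  inP_of_tabProg (decideProg unfrozenProg)
    (scoped_decideProg (by simp [unfrozenProg, failProg, Scoped])) .ok _ <|
    run_decideProg (R := fun a b => a ∧ b) isCheck_unfrozenProg
      fun _ G => isUnfrozen_vertexCoverNum_iff G

theorem inP_frozen :
    InP (bipartiteProblem fun _ G => IsFrozen SimpleGraph.vertexCoverNum G) :=
  inP_of_tabProg (decideProg frozenProg)
    (scoped_decideProg (by simp [frozenProg, failProg, Scoped])) .ok _ <|
    run_decideProg (R := fun a b => ¬ (a ∧ b)) isCheck_frozenProg
      fun _ G => by simpa only [not_not] using isFrozen_vertexCoverNum_iff G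

end GraphUnfrozen

/-- For bipartite graphs, the problems `β`-Unfrozenness, `α`-Unfrozenness and `β`-Frozenness
belong to `P`. -/
theorem mainTheorem4 :
    GraphUnfrozen.InP (GraphUnfrozen.bipartiteProblem fun _ G =>
      GraphUnfrozen.IsUnfrozen SimpleGraph.vertexCoverNum G) ∧
    GraphUnfrozen.InP (GraphUnfrozen.bipartiteProblem fun _ G =>
      GraphUnfrozen.IsUnfrozen SimpleGraph.indepNum G) ∧
    GraphUnfrozen.InP (GraphUnfrozen.bipartiteProblem fun _ G =>
      GraphUnfrozen.IsFrozen SimpleGraph.vertexCoverNum G) := by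
  refine ⟨GraphUnfrozen.inP_unfrozen, ?_, GraphUnfrozen.inP_frozen⟩
  simp only [GraphUnfrozen.isUnfrozen_indepNum_iff]
  exact GraphUnfrozen.inP_unfrozen
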